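/- \textbf{Setting.} Let $n\ge 2$ and let $\mathcal T$ be a vector addition system (VAS) of dimension $n$, i.e. a finite nonempty set $\mathcal T\subseteq\mathbb Z^n$ of transitions. Put $\|\mathcal T\|=\max\{|b(i)| : b\in\mathcal T,\ 1\le i\le n\}$ and $\|\mathcal T\|^-=\max\{\max(0,-b(i)) : b\in\mathcal T,\ 1\le i\le n\}$, and assume $\|\mathcal T\|^-\ge 1$. A \emph{pseudo-run} is given by an initial vector $u_0\in\mathbb Z^n$ and a finite sequence $t_1,\dots,t_k\in\mathcal T$ ($k\ge 0$); it is the sequence $u_0,\dots,u_k$ in $\mathbb Z^n$ with $u_i=u_{i-1}+t_i$, and its length is $k+1$. A \emph{generalized unboundedness property} of length $K\ge 1$ is a sequence $\mathcal P=(\mathcal I_1,\dots,\mathcal I_K)$ of $n$-tuples of intervals of $\mathbb Z$, each of the form $]-\infty,+\infty[$, $[a,+\infty[$, $]-\infty,b]$ or $[a,b]$ with $a,b\in\mathbb Z$. Its scale $\|\mathcal P\|$ is the maximum of $1$ and of the absolute values of the integers occurring in these interval expressions. A pseudo-run $u_0,\dots,u_k$ \emph{weakly satisfies} $\mathcal P$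 if there are positions $0=f(0)\le f(1)\le\dots\le f(2K)=k$ such that, with $x_i=u_{f(i)}$: (P1) $x_{2l}(j)-x_{2l-1}(j)\in\mathcal I_l(j)$ for all $1\le l\le K$ and $1\le j\le n$; (P2) for all $1\le l\le K$ and $1\le j\le n$, if $x_{2l}(j)-x_{2l-1}(j)<0$, then $x_{2l'}(j)-x_{2l'-1}(j)>0$ for some $1\le l'<l$; (P3) for all $1\le j\le n$ and $0\le i\le k$, if $u_i(j)<0$, then there is $1\le l\le K$ with $f(2l)<i$ and $x_{2l}(j)-x_{2l-1}(j)>0$. \textbf{Lemma.} There is a constant $C>1$, independent of $n$, $\mathcal T$, $K$, $\mathcal P$ and the pseudo-run, such that the following holds. If a pseudo-run of $\mathcal T$ weakly satisfies a generalized unboundedness property $\mathcal P$ of length $K$, then there is a pseudo-run of $\mathcal T$ starting from the same vector, weakly satisfying $\mathcal P$, and of length at most $$\bigl(2\,\mu\,\|\mathcal T\|^-\bigr)^{\,n^{(2n+1)C}},\qquad \mu=(1+K)\cdot\|\mathcal T\|\cdot\|\mathcal P\|.$$ -/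

import Mathlib

namespace GenUnbound

/-- Interval expressions over the integers: `]-∞,+∞[`, `[a,+∞[`, `]-∞,b]` and `[a,b]`. -/
inductive Interval : Type where
  | all : Interval
  | ge (a : ℤ) : Interval
  | le (b : ℤ) : Interval
  | between (a b : ℤ) : Interval

namespace Interval

/-- The set of integers denoted by an interval expression. -/
def toSet : Interval → Set ℤ
  | all => Set.univ
  | ge a => Set.Ici a
  | le b => Set.Iic b
  | between a b => Set.Icc a b

/-- The maximal absolute value of an integer occurring in the expression (`0` if none occurs). -/
def absMax : Interval → ℕ
  | all => 0
  | ge a => a.natAbs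
  | le b => b.natAbs
  | between a b => max a.natAbs b.natAbs

end Interval

/-- A generalized unboundedness property of dimension `n` and length `K`: a sequence of `K`
tuples of intervals (the length of a property is required to be positive where it is used).
The sequence is indexed from `0`, so `P l` is the `(l+1)`-st tuple. -/
abbrev Property (n K : ℕ) : Type := Fin K → Fin n → Interval

/-- The scale of a property: the maximum of `1` and of the absolute values of all integers
occurring in its interval expressions. -/
def Property.scale {n K : ℕ} (P : Property n K) : ℕ :=
  max 1 (Finset.univ.sup fun l => Finset.univ.sup fun j => (P l j).absMax)

/-- `‖T‖`: the maximal absolute value of a component of a transition of the VAS `T`. -/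
def absNorm {n : ℕ} (T : Finset (Fin n → ℤ)) : ℕ :=
  T.sup fun b => Finset.univ.sup fun i => (b i).natAbs

/-- `‖T‖⁻`: the maximum of all `max (0, -b(i))` for a transition `b` of the VAS `T`. -/
def negNorm {n : ℕ} (T : Finset (Fin n → ℤ)) : ℕ :=
  T.sup fun b => Finset.univ.sup fun i => (-(b i)).toNat

/-- A (finite) pseudo-run of the VAS `T`, given by an initial pseudo-configuration in `ℤⁿ` and a
path, i.e. a finite sequence of transitions of `T`. -/
structure PseudoRun {n : ℕ} (T : Finset (Fin n → ℤ)) : Type where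
  start : Fin n → ℤ
  path : List (Fin n → ℤ)
  path_mem : ∀ t ∈ path, t ∈ T

namespace PseudoRun

variable {n : ℕ} {T : Finset (Fin n → ℤ)}

/-- The pseudo-configuration `u_i` (for `i ≤ ρ.path.length`) of the pseudo-run. -/
def config (ρ : PseudoRun T) (i : ℕ) : Fin n → ℤ :=
  ρ.start + (ρ.path.take i).sum

/-- The length of a pseudo-run is its number of pseudo-configurations. -/
def length (ρ : PseudoRun T) : ℕ := ρ.path.length + 1

/-- `f` describes a decomposition
`x_0 →[π'_0] x_1 →[π_1] x_2 →[π'_1] x_3 ⋯ →[π'_{K-1}] x_{2K-1} →[π_K] x_{2K}`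
of the pseudo-run: `x_i` is its pseudo-configuration at position `f i`, for `0 ≤ i ≤ 2K`.
Only the values `f 0, …, f (2 * K)` matter. -/
def IsDecomposition (ρ : PseudoRun T) (K : ℕ) (f : ℕ → ℕ) : Prop :=
  f 0 = 0 ∧ f (2 * K) = ρ.path.length ∧ ∀ i < 2 * K, f i ≤ f (i + 1)

/-- The effect `x_{2l+2} - x_{2l+1}` of the path `π_{l+1}`, for `0 ≤ l < K`. -/
def effect (ρ : PseudoRun T) (f : ℕ → ℕ) (l : ℕ) : Fin n → ℤ :=
  ρ.config (f (2 * l + 2)) - ρ.config (f (2 * l + 1))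

/-- The pseudo-run weakly satisfies `P`: some decomposition satisfies (P1), (P2) and (P3).
(A VAS has a single control state, so there is no condition on control states.) -/
def WeaklySatisfies {K : ℕ} (ρ : PseudoRun T) (P : Property n K) : Prop :=
  ∃ f : ℕ → ℕ, ρ.IsDecomposition K f ∧
    (∀ (l : Fin K) (j : Fin n), ρ.effect f l j ∈ (P l j).toSet) ∧
    (∀ (l : Fin K) (j : Fin n), ρ.effect f l j < 0 → ∃ l' : Fin K, l' < l ∧ 0 < ρ.effect f l' j) ∧
    (∀ (j : Fin n) (i : ℕ), i ≤ ρ.path.length → ρ.config i j < 0 →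
      ∃ l : Fin K, f (2 * l + 2) < i ∧ 0 < ρ.effect f l j)

end PseudoRun

end GenUnbound

/-!
Split a weakly satisfying pseudo-run into its `K` segments. In the `l`-th segment, the coordinates
that have not increased in an earlier segment must remain nonnegative, and, by (P2), they do not
decrease over the paths whose effects are constrained by (P1). Prescribing also the signs of these
effects turns weak satisfaction into the solvability of such a list of segments.

Following Rackoff, short solutions are found by induction on the number of coordinates that must
remain nonnegative. If `L` bounds the solutions for one coordinate less, a coordinate that reaches
`‖T‖⁻ * L` can be ignored from then on. As long as all coordinates are below this value, the path
is a walk in a finite set of nodes: it is a short walk into which loops are inserted, and how often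
each effect of a loop is used is a natural solution of a system of linear equations. A system with
small coefficients has a small solution, so that few loops are enough. The bound obtained for fewer
than `c` coordinates is `B ^ n ^ (8 * c + 1)` for `B` polynomial in the data.
-/

namespace GenUnbound

open scoped Matrix

section Extend

variable {α ι κ R : Type*} {e : κ → ι}

lemma mulVec_extend [Fintype ι] [Fintype κ] [NonUnitalNonAssocSemiring R] (A : Matrix α ι R)
    (he : Function.Injective e) (y : κ → R) :
    A *ᵥ Function.extend e y 0 = A.submatrix id e *ᵥ y := by
  ext a
  refine (Fintype.sum_of_injective e he _ _ (fun i hi => ?_) fun k => ?_).symm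
  · simp [Function.extend_apply' _ _ _ (by simpa using hi)]
  · simp [he.extend_apply]

lemma extend_zero_ne_zero [Zero R] (he : Function.Injective e) {y : κ → R} (hy : y ≠ 0) :
    Function.extend e y 0 ≠ 0 := fun h =>
  hy (funext fun k => by simpa [he.extend_apply] using congrFun h (e k))

lemma natAbs_extend_zero_le (he : Function.Injective e) {y : κ → ℤ} {b : ℕ}
    (hy : ∀ k, (y k).natAbs ≤ b) (i : ι) : (Function.extend e y 0 i).natAbs ≤ b := by
  by_cases hi : ∃ k, e k = i
  · obtain ⟨k, rfl⟩ := hi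
    exact (he.extend_apply y 0 k).symm ▸ hy k
  · simp [Function.extend_apply' _ _ _ hi]

lemma extend_comp_of_forall_eq_zero [Zero R] (he : Function.Injective e) {x : ι → R}
    (hx : ∀ i, i ∉ Set.range e → x i = 0) : Function.extend e (x ∘ e) 0 = x := by
  ext i
  by_cases hi : ∃ k, e k = i
  · obtain ⟨k, rfl⟩ := hi
    exact he.extend_apply _ _ k
  · exact (Function.extend_apply' _ _ _ hi).trans (hx i hi).symm

end Extend

section LinearSystems

variable {α ι : Type*} [Fintype ι]

section Siegel

attribute [local instance] Matrix.seminormedAddCommGroup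

lemma exists_small_ker_of_card_lt [Fintype α] (A : Matrix α ι ℤ) {N : ℕ} (hN : 1 ≤ N)
    (hA : ∀ a i, (A a i).natAbs ≤ N) (hlt : Fintype.card α < Fintype.card ι) :
    ∃ y : ι → ℤ, y ≠ 0 ∧ A *ᵥ y = 0 ∧
      ∀ i, (y i).natAbs ≤ (Fintype.card ι * N) ^ Fintype.card α := by
  classical
  rcases Nat.eq_zero_or_pos (Fintype.card α) with h0 | hpos
  · have : IsEmpty α := Fintype.card_eq_zero_iff.mp h0
    have : Nonempty ι := Fintype.card_pos_iff.mp (by lia)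
    exact ⟨1, one_ne_zero, Subsingleton.elim _ _, by simp⟩
  obtain ⟨y, hy0, hAy, hy⟩ := Int.Matrix.exists_ne_zero_int_vec_norm_le A hlt hpos
  refine ⟨y, hy0, hAy, fun i => ?_⟩
  have hι : (Fintype.card α : ℝ) + 1 ≤ Fintype.card ι := by exact_mod_cast hlt
  have hN' : (1 : ℝ) ≤ N := by exact_mod_cast hN
  have hnorm : ‖A‖ ≤ N := by
    refine (Matrix.norm_le_iff (by positivity)).mpr fun a i => ?_
    rw [Int.norm_eq_abs, ← Int.cast_abs, Int.abs_eq_natAbs]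
    exact_mod_cast hA a i
  have hexp : (Fintype.card α : ℝ) / (Fintype.card ι - Fintype.card α) ≤ Fintype.card α :=
    div_le_self (by positivity) (by linarith)
  have hbase : 1 ≤ (Fintype.card ι : ℝ) * max 1 ‖A‖ :=
    one_le_mul_of_one_le_of_one_le (by linarith [(Fintype.card α).cast_nonneg (α := ℝ)])
      (le_max_left _ _)
  suffices ((y i).natAbs : ℝ) ≤ (Fintype.card ι * N) ^ Fintype.card α by exact_mod_cast this
  calc ((y i).natAbs : ℝ) = ‖y i‖ := by simp [Int.norm_eq_abs]
    _ ≤ ‖y‖ := norm_le_pi_norm y i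
    _ ≤ _ := hy
    _ ≤ (Fintype.card ι * max 1 ‖A‖) ^ (Fintype.card α : ℝ) :=
      Real.rpow_le_rpow_of_exponent_le hbase hexp
    _ = (Fintype.card ι * max 1 ‖A‖) ^ Fintype.card α := Real.rpow_natCast _ _
    _ ≤ (Fintype.card ι * N) ^ Fintype.card α := by gcongr; exact max_le hN' hnorm

end Siegel

lemma card_lt_of_linearIndepOn_of_mulVec_eq_zero {R : Type*} [CommRing R] [IsDomain R]
    {A : Matrix α ι R} {s : Finset α} (hs : LinearIndepOn R A.row (s : Set α)) {x : ι → R}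
    (hx : x ≠ 0) (hAx : A *ᵥ x = 0) : s.card < Fintype.card ι := by
  classical
  by_contra! hle
  obtain ⟨e⟩ : Nonempty (ι ↪ s) := Function.Embedding.nonempty_of_card_le (by simpa using hle)
  let B : Matrix ι ι R := A.submatrix (fun i => (e i : α)) id
  have hdet : B.det = 0 :=
    Matrix.exists_mulVec_eq_zero_iff.mp ⟨x, hx, funext fun i => congrFun hAx (e i)⟩
  obtain ⟨c, hc, hcB⟩ := Matrix.exists_vecMul_eq_zero_iff.mpr hdet
  have hrow : LinearIndependent R B.row := LinearIndependent.comp hs e e.injective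
  exact hc (Matrix.vecMul_injective_iff.mpr hrow (by simpa using hcB))

lemma exists_card_lt_forall_mulVec_eq_zero [Finite α] {R : Type*} [CommRing R] [IsDomain R]
    (A : Matrix α ι R) {x : ι → R} (hx : x ≠ 0) (hAx : A *ᵥ x = 0) :
    ∃ s : Finset α, s.card < Fintype.card ι ∧
      ∀ y, (∀ a ∈ s, (A *ᵥ y) a = 0) → A *ᵥ y = 0 := by
  classical
  obtain ⟨s, hs, hmax⟩ := exists_maximal_linearIndepOn R A.row
  lift s to Finset α using s.toFinite
  refine ⟨s, card_lt_of_linearIndepOn_of_mulVec_eq_zero hs hx hAx, fun y hy => funext fun a => ?_⟩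
  by_cases ha : a ∈ s
  · exact hy a ha
  obtain ⟨c, hc, hspan⟩ := hmax a (by simpa using ha)
  have hle : Submodule.span R (A.row '' s) ≤ ((dotProductBilin R R).flip y).ker :=
    Submodule.span_le.mpr (Set.image_subset_iff.mpr fun b hb => hy b hb)
  have : c * (A.row a ⬝ᵥ y) = 0 := by simpa using hle hspan
  exact (mul_eq_zero.mp this).resolve_left hc

/-- A bound for the entries of some kernel vector of an integer matrix with `n` rows and entries
of absolute value at most `N`, provided that the kernel is nontrivial. -/
def kerBound (n N : ℕ) : ℕ := ((n + 1) * N) ^ n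

lemma kerBound_mono (n : ℕ) : Monotone (kerBound n) := fun N N' h => by
  unfold kerBound
  gcongr

/-- After restricting to the support of `x` and to a basis of the row space, there are fewer
equations than unknowns, and Siegel's lemma applies to `rank + 1` of the unknowns. -/
lemma exists_small_ker [Fintype α] (A : Matrix α ι ℤ) {N : ℕ} (hN : 1 ≤ N)
    (hA : ∀ a i, (A a i).natAbs ≤ N) {x : ι → ℤ} (hx : x ≠ 0) (hAx : A *ᵥ x = 0) :
    ∃ y : ι → ℤ, y ≠ 0 ∧ A *ᵥ y = 0 ∧ (∀ i, x i = 0 → y i = 0) ∧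
      ∀ i, (y i).natAbs ≤ kerBound (Fintype.card α) N := by
  classical
  let v : {i // x i ≠ 0} → ι := (↑)
  have hv : Function.Injective v := Subtype.val_injective
  have hxv : Function.extend v (x ∘ v) 0 = x :=
    extend_comp_of_forall_eq_zero hv fun i hi => not_not.mp fun h => hi ⟨⟨i, h⟩, rfl⟩
  obtain ⟨s, hs, hker⟩ := exists_card_lt_forall_mulVec_eq_zero (A.submatrix id v) (x := x ∘ v)
    (fun h => hx (funext fun i => not_not.mp fun hi => hi (congrFun h ⟨i, hi⟩)))
    (by rw [← mulVec_extend A hv, hxv, hAx])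
  obtain ⟨e⟩ : Nonempty (Fin (s.card + 1) ↪ {i // x i ≠ 0}) :=
    Function.Embedding.nonempty_of_card_le (by simpa using hs)
  obtain ⟨y, hy0, hAy, hy⟩ := exists_small_ker_of_card_lt
    ((A.submatrix id v).submatrix ((↑) : s → α) e) hN (fun _ _ => hA _ _) (by simp)
  have hAey := hker (Function.extend e y 0) fun a ha => by
    rw [mulVec_extend _ e.injective]
    exact congrFun hAy ⟨a, ha⟩
  refine ⟨Function.extend v (Function.extend e y 0) 0,
    extend_zero_ne_zero hv (extend_zero_ne_zero e.injective hy0), by rw [mulVec_extend A hv, hAey],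
    fun i hi => Function.extend_apply' _ _ _ ?_, fun i => ?_⟩
  · rintro ⟨k, rfl⟩
    exact k.2 hi
  · refine (natAbs_extend_zero_le hv (natAbs_extend_zero_le e.injective hy) i).trans ?_
    have := Finset.card_le_univ s
    simp only [Fintype.card_fin, Fintype.card_coe, kerBound]
    gcongr
    lia

/-- If `z` is the lexicographically least solution and `y` is a nonzero kernel vector with
`|y| ≤ z`, then one of `z + y` and `z - y` is a smaller solution. -/
lemma exists_solution_not_dominating_ker (A : Matrix α ι ℤ) (x : ι → ℕ) :
    ∃ z : ι → ℕ, A *ᵥ (fun i => (z i : ℤ)) = A *ᵥ (fun i => (x i : ℤ)) ∧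
      ∀ y : ι → ℤ, A *ᵥ y = 0 → (∀ i, (y i).natAbs ≤ z i) → y = 0 := by
  let : LinearOrder ι := IsWellOrder.linearOrder WellOrderingRel
  obtain ⟨z, hz, hmin⟩ := (wellFounded_lt (α := Lex (ι → ℕ))).has_min
    {z | A *ᵥ (fun i => (ofLex z i : ℤ)) = A *ᵥ (fun i => (x i : ℤ))} ⟨toLex x, rfl⟩
  refine ⟨ofLex z, hz, fun y hAy hyz => ?_⟩
  have le_add : ∀ u : ι → ℤ, A *ᵥ u = 0 → (∀ i, (u i).natAbs ≤ ofLex z i) →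
      ∀ i, (∀ j < i, u j = 0) → 0 ≤ u i := by
    intro u hAu huz i hu
    have hcast : (fun j => ((ofLex z j + u j).toNat : ℤ)) = (fun j => (ofLex z j : ℤ)) + u :=
      funext fun j => Int.toNat_of_nonneg (by have := huz j; lia)
    have hle := not_lt.mp (hmin (toLex fun j => (ofLex z j + u j).toNat) (by
      rw [Set.mem_ofPred_eq, ofLex_toLex, hcast, Matrix.mulVec_add, hAu, add_zero]
      exact hz))
    have : ofLex z i ≤ (ofLex z i + u i).toNat :=
      Pi.apply_le_of_toLex hle fun j hj => by simp [hu j hj]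
    have := huz i
    lia
  ext i
  induction i using WellFoundedLT.induction with | _ i ih => ?_
  have hpos := le_add y hAy hyz i ih
  have hneg := le_add (-y) (by rw [Matrix.mulVec_neg, hAy, neg_zero]) (by simpa using hyz) i
    (by simpa using ih)
  exact le_antisymm (neg_nonneg.mp hneg) hpos

lemma natAbs_mulVec_le {A : Matrix α ι ℤ} {N b : ℕ} (hA : ∀ a i, (A a i).natAbs ≤ N)
    {x : ι → ℤ} (hx : ∀ i, (x i).natAbs ≤ b) (a : α) :
    ((A *ᵥ x) a).natAbs ≤ Fintype.card ι * (N * b) :=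
  calc ((A *ᵥ x) a).natAbs ≤ ∑ i, (A a i * x i).natAbs := Int.natAbs_sum_le _ _
    _ ≤ ∑ _i : ι, N * b := Finset.sum_le_sum fun i _ => by
      rw [Int.natAbs_mul]
      exact Nat.mul_le_mul (hA a i) (hx i)
    _ = Fintype.card ι * (N * b) := by simp

/-- The vector `(-1, x)` lies in the kernel of the matrix `A` extended by the column `A *ᵥ x`, and
uniqueness makes every kernel vector of this matrix a multiple of `(-1, x)`. -/
lemma natAbs_le_kerBound_of_unique [Fintype α] {A : Matrix α ι ℤ} {N : ℕ} (hN : 1 ≤ N)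
    (hA : ∀ a i, (A a i).natAbs ≤ N) {x : ι → ℤ} (hAx : ∀ a, ((A *ᵥ x) a).natAbs ≤ N)
    (huniq : ∀ y : ι → ℤ, A *ᵥ y = 0 → (∀ i, x i = 0 → y i = 0) → y = 0) (i : ι) :
    (x i).natAbs ≤ kerBound (Fintype.card α) N := by
  have hmul (y : Unit ⊕ ι → ℤ) : Matrix.fromCols (Matrix.replicateCol Unit (A *ᵥ x)) A *ᵥ y =
      A *ᵥ (y (Sum.inl ()) • x + y ∘ Sum.inr) := by
    rw [Matrix.fromCols_mulVec, Matrix.mulVec_add, Matrix.mulVec_smul]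
    congr 1
    ext a
    simp [Matrix.mulVec, dotProduct, mul_comm]
  obtain ⟨y, hy0, hAy, hsupp, hy⟩ := exists_small_ker
    (Matrix.fromCols (Matrix.replicateCol Unit (A *ᵥ x)) A) hN
    (fun a => Sum.forall.mpr ⟨fun _ => hAx a, hA a⟩) (x := Sum.elim (fun _ => -1) x)
    (fun h => by simpa using congrFun h (Sum.inl ())) (by simp [hmul])
  have hinr : y (Sum.inl ()) • x + y ∘ Sum.inr = 0 :=
    huniq _ (hmul y ▸ hAy) fun i hi => by simp [hi, hsupp (Sum.inr i) hi]
  have hinl : y (Sum.inl ()) ≠ 0 := by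
    intro h0
    rw [h0, zero_smul, zero_add] at hinr
    exact hy0 (funext (Sum.forall.mpr ⟨fun _ => h0, congrFun hinr⟩))
  have heq : y (Sum.inr i) = -(y (Sum.inl ()) * x i) :=
    eq_neg_of_add_eq_zero_right (congrFun hinr i)
  calc (x i).natAbs ≤ (y (Sum.inl ())).natAbs * (x i).natAbs :=
      Nat.le_mul_of_pos_left _ (Int.natAbs_pos.mpr hinl)
    _ = (y (Sum.inr i)).natAbs := by rw [heq, Int.natAbs_neg, Int.natAbs_mul]
    _ ≤ kerBound (Fintype.card α) N := hy _

/-- A bound for the entries of some natural solution of a solvable system of `n` linear equations in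
`m` unknowns, with coefficients of absolute value at most `N` and right-hand sides of absolute
value at most `R`. -/
def solutionBound (n m N R : ℕ) : ℕ := kerBound n (R + m * (N * kerBound n N) + N)

lemma solutionBound_mono (n N R : ℕ) : Monotone fun m => solutionBound n m N R :=
  fun m m' h => kerBound_mono n (by gcongr)

lemma exists_small_solution [Fintype α] (A : Matrix α ι ℤ) {N R : ℕ} (hN : 1 ≤ N)
    (hA : ∀ a i, (A a i).natAbs ≤ N) (x : ι → ℕ)
    (hR : ∀ a, ((A *ᵥ fun i => (x i : ℤ)) a).natAbs ≤ R) :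
    ∃ z : ι → ℕ, A *ᵥ (fun i => (z i : ℤ)) = A *ᵥ (fun i => (x i : ℤ)) ∧
      ∀ i, z i ≤ solutionBound (Fintype.card α) (Fintype.card ι) N R := by
  classical
  obtain ⟨z, hz, hker⟩ := exists_solution_not_dominating_ker A x
  refine ⟨z, hz, fun i => ?_⟩
  set b := kerBound (Fintype.card α) N
  let large : ι → ℤ := fun i => if b < z i then z i else 0
  let small : ι → ℤ := fun i => if b < z i then 0 else z i
  have hsmall : ∀ a, ((A *ᵥ small) a).natAbs ≤ Fintype.card ι * (N * b) :=
    natAbs_mulVec_le hA fun i => by simp only [small]; split_ifs <;> lia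
  have hsplit : (fun i => (z i : ℤ)) = large + small :=
    funext fun i => by simp only [large, small, Pi.add_apply]; split_ifs <;> simp
  have hlarge : ∀ a, ((A *ᵥ large) a).natAbs ≤ R + Fintype.card ι * (N * b) + N := by
    intro a
    have hRa := hR a
    rw [← hz, hsplit, Matrix.mulVec_add, Pi.add_apply] at hRa
    have := hsmall a
    lia
  have huniq : ∀ y : ι → ℤ, A *ᵥ y = 0 → (∀ i, large i = 0 → y i = 0) → y = 0 := by
    intro y hAy hsupp
    by_contra hy
    obtain ⟨y', hy'0, hAy', hsupp', hy'⟩ := exists_small_ker A hN hA hy hAy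
    refine hy'0 (hker y' hAy' fun i => ?_)
    by_cases hi : b < z i
    · exact (hy' i).trans hi.le
    · simp [hsupp' i (hsupp i (if_neg hi))]
  have hN' : N ≤ R + Fintype.card ι * (N * b) + N := Nat.le_add_left _ _
  by_cases hi : b < z i
  · have hzi : (large i).natAbs = z i := by simp only [large, if_pos hi, Int.natAbs_natCast]
    exact hzi ▸ natAbs_le_kerBound_of_unique (hN.trans hN') (fun a i => (hA a i).trans hN') hlarge
      huniq i
  · exact (not_lt.mp hi).trans (kerBound_mono _ hN')

end LinearSystems

section Walks

variable {G H : Type*} [AddCommGroup G] [AddCommGroup H] {φ : G →+ H} {T : Set G} {F : Set H}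
  {h : H} {p q : List G}

/-- The nodes visited when the steps `φ t`, for `t` in the list `p`, are taken in turn from `h`. -/
def visited (φ : G →+ H) (h : H) (p : List G) : Set H :=
  {x | ∃ q, q <+: p ∧ h + φ q.sum = x}

lemma start_mem_visited : h ∈ visited φ h p :=
  ⟨[], List.nil_prefix, by simp⟩

lemma end_mem_visited : h + φ p.sum ∈ visited φ h p :=
  ⟨p, List.prefix_rfl, rfl⟩

lemma visited_nil : visited φ h [] = {h} := by
  ext x
  simp [visited, eq_comm]

lemma visited_append :
    visited φ h (p ++ q) = visited φ h p ∪ visited φ (h + φ p.sum) q := by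
  ext x
  constructor
  · rintro ⟨r, hr, rfl⟩
    rcases List.prefix_or_prefix_of_prefix hr (List.prefix_append p q) with hrp | ⟨s, rfl⟩
    · exact Or.inl ⟨r, hrp, rfl⟩
    · exact Or.inr ⟨s, by simpa using hr, by simp [add_assoc]⟩
  · rintro (⟨r, hr, rfl⟩ | ⟨r, hr, rfl⟩)
    · exact ⟨r, hr.trans (List.prefix_append p q), rfl⟩
    · exact ⟨p ++ r, by simpa using hr, by simp [add_assoc]⟩

lemma visited_concat {t : G} :
    visited φ h (p ++ [t]) = insert (h + φ (p ++ [t]).sum) (visited φ h p) := by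
  ext x
  simp only [visited, List.prefix_concat_iff, Set.mem_insert_iff, Set.mem_ofPred_eq]
  grind

lemma finite_visited (φ : G →+ H) (h : H) (p : List G) : (visited φ h p).Finite := by
  induction p using List.reverseRecOn with
  | nil => simp [visited_nil]
  | append_singleton p t ih => exact visited_concat (φ := φ) ▸ ih.insert _

variable (φ T F h p) in
/-- The list `p` of elements of `T` is a walk from `h` that stays in `F`, where `t ∈ T` acts on the
nodes as the translation by `φ t`. -/
structure IsWalk : Prop where
  mem : ∀ t ∈ p, t ∈ T
  visited_subset : visited φ h p ⊆ F

lemma isWalk_iff : IsWalk φ T F h p ↔ (∀ t ∈ p, t ∈ T) ∧ visited φ h p ⊆ F :=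
  ⟨fun hp => ⟨hp.mem, hp.visited_subset⟩, fun hp => ⟨hp.1, hp.2⟩⟩

lemma isWalk_append :
    IsWalk φ T F h (p ++ q) ↔ IsWalk φ T F h p ∧ IsWalk φ T F (h + φ p.sum) q := by
  simp only [isWalk_iff, visited_append, Set.union_subset_iff, List.forall_mem_append]
  tauto

lemma isWalk_nil : IsWalk φ T F h [] ↔ h ∈ F := by
  simp [isWalk_iff, visited_nil]

lemma visited_map {v : G} : visited φ (φ v) p = φ '' visited (AddMonoidHom.id G) v p := by
  ext x
  simp only [visited, Set.mem_image, Set.mem_ofPred_eq, AddMonoidHom.id_apply]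
  constructor
  · rintro ⟨q, hq, rfl⟩
    exact ⟨v + q.sum, ⟨q, hq, rfl⟩, map_add φ v q.sum⟩
  · rintro ⟨_, ⟨q, hq, rfl⟩, rfl⟩
    exact ⟨q, hq, (map_add φ v q.sum).symm⟩

lemma isWalk_map {v : G} :
    IsWalk φ T F (φ v) p ↔ IsWalk (AddMonoidHom.id G) T (φ ⁻¹' F) v p := by
  rw [isWalk_iff, isWalk_iff, visited_map, Set.image_subset_iff]

lemma IsWalk.mono {F' : Set H} (hp : IsWalk φ T F h p) (hF : F ⊆ F') : IsWalk φ T F' h p :=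
  ⟨hp.mem, hp.visited_subset.trans hF⟩

lemma isWalk_or_exists_first_exit (hp : ∀ t ∈ p, t ∈ T) (F : Set H) :
    IsWalk φ T F h p ∨ ∃ p₁, p₁ <+: p ∧ h + φ p₁.sum ∉ F ∧
      ∀ r t, p₁ = r ++ [t] → IsWalk φ T F h r := by
  induction p using List.reverseRecOn with
  | nil =>
    by_cases hh : h ∈ F
    · exact Or.inl (isWalk_nil.mpr hh)
    · exact Or.inr ⟨[], List.nil_prefix, by simpa using hh, by simp⟩
  | append_singleton p t ih =>
    rcases ih fun s hs => hp s (List.mem_append_left _ hs) with hpF | ⟨p₁, hp₁, hexit⟩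
    · by_cases hend : h + φ (p ++ [t]).sum ∈ F
      · refine Or.inl ⟨hp, ?_⟩
        rw [visited_concat]
        exact Set.insert_subset hend hpF.visited_subset
      · refine Or.inr ⟨p ++ [t], List.prefix_rfl, hend, fun r s hrs => ?_⟩
        exact (List.append_inj' hrs rfl).1 ▸ hpF
    · exact Or.inr ⟨p₁, hp₁.trans (List.prefix_append p [t]), hexit⟩

variable (φ T F) in
/-- The effects of the loops of length at most `N` anchored at the nodes in `V`. -/
def loopEffects (V : Set H) (N : ℕ) : Set G :=
  {e | ∃ x ∈ V, ∃ l, IsWalk φ T F x l ∧ φ l.sum = 0 ∧ l.length ≤ N ∧ l.sum = e}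

lemma loopEffects_mono {V V' : Set H} (hV : V ⊆ V') (N : ℕ) :
    loopEffects φ T F V N ⊆ loopEffects φ T F V' N := by
  rintro e ⟨x, hx, hl⟩
  exact ⟨x, hV hx, hl⟩

lemma map_eq_zero_of_mem_closure_loopEffects {V : Set H} {N : ℕ} {c : G}
    (hc : c ∈ AddSubmonoid.closure (loopEffects φ T F V N)) : φ c = 0 := by
  suffices AddSubmonoid.closure (loopEffects φ T F V N) ≤ AddMonoidHom.mker φ from this hc
  rw [AddSubmonoid.closure_le]
  rintro _ ⟨_, _, l, _, hl, _, rfl⟩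
  exact hl

end Walks

section Skeletons

variable {G H : Type*} [AddCommGroup G] [AddCommGroup H] {φ : G →+ H} {T : Set G} {F : Finset H}
  {h : H} {p : List G}

lemma exists_eq_append_loop (hp : IsWalk φ T F h p) (hlen : F.card ≤ p.length) :
    ∃ a l b, p = a ++ l ++ b ∧ l ≠ [] ∧ l.length ≤ F.card ∧ φ l.sum = 0 := by
  classical
  obtain ⟨i, hi, j, hj, hij, heq⟩ := Finset.exists_ne_map_eq_of_card_lt_of_maps_to
    (s := Finset.range (F.card + 1)) (t := F) (f := fun i => h + φ (p.take i).sum) (by simp)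
    (fun i _ => hp.visited_subset ⟨p.take i, List.take_prefix i p, rfl⟩)
  wlog hlt : i < j generalizing i j
  · exact this j hj i hi hij.symm heq.symm (by lia)
  have hj' : j ≤ F.card := by simpa [Nat.lt_succ_iff] using hj
  have htake : p.take j = p.take i ++ (p.drop i).take (j - i) := by
    rw [← List.take_add, Nat.add_sub_cancel' hlt.le]
  refine ⟨p.take i, (p.drop i).take (j - i), p.drop j, ?_, ?_, ?_, ?_⟩
  · rw [← htake, List.take_append_drop]
  · simp only [ne_eq, List.take_eq_nil_iff, List.drop_eq_nil_iff]
    lia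
  · simp only [List.length_take, List.length_drop]
    lia
  · simpa [htake] using heq

/-- Cutting loops of length at most `F.card` until none is left. -/
lemma exists_isWalk_length_lt_card (hp : IsWalk φ T F h p) :
    ∃ r, IsWalk φ T F h r ∧ r.length < F.card ∧ visited φ h r ⊆ visited φ h p ∧
      ∃ c ∈ AddSubmonoid.closure (loopEffects φ T F (visited φ h p) F.card), p.sum = r.sum + c := by
  induction hn : p.length using Nat.strong_induction_on generalizing p with | _ n ih => ?_
  subst hn
  by_cases hlen : p.length < F.card
  · exact ⟨p, hp, hlen, subset_rfl, 0, zero_mem _, (add_zero _).symm⟩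
  obtain ⟨a, l, b, rfl, hl, hlF, hφ⟩ := exists_eq_append_loop hp (not_lt.mp hlen)
  have hab : IsWalk φ T F h (a ++ b) := by
    simp only [isWalk_append, List.sum_append, map_add, hφ, add_zero] at hp ⊢
    exact ⟨hp.1.1, hp.2⟩
  have hvis : visited φ h (a ++ b) ⊆ visited φ h (a ++ l ++ b) := by
    simp only [visited_append, List.sum_append, map_add, hφ, add_zero]
    grind
  obtain ⟨r, hr, hrF, hrvis, c, hc, hsum⟩ := ih _ (by
    have := List.length_pos_iff.mpr hl
    simp only [List.length_append]
    lia) hab rfl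
  have hle : l.sum ∈ loopEffects φ T F (visited φ h (a ++ l ++ b)) F.card := by
    refine ⟨h + φ a.sum, ?_, l, (isWalk_append.mp (isWalk_append.mp hp).1).2, hφ, hlF, rfl⟩
    exact ⟨a, by simp, rfl⟩
  refine ⟨r, hr, hrF, hrvis.trans hvis, l.sum + c, add_mem (AddSubmonoid.subset_closure hle)
    (AddSubmonoid.closure_mono (loopEffects_mono hvis _) hc), ?_⟩
  calc (a ++ l ++ b).sum = l.sum + (a ++ b).sum := by simp only [List.sum_append]; abel
    _ = r.sum + (l.sum + c) := by rw [hsum]; abel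

variable (φ T F h) in
/-- A short walk `q` that visits the nodes in `V` and has the effect `x` up to a sum of effects of
short loops anchored in `V`. -/
structure IsSkeleton (V : Set H) (x : G) (q : List G) : Prop where
  isWalk : IsWalk φ T F h q
  visited_eq : visited φ h q = V
  length_lt : q.length < V.ncard * F.card
  exists_loops : ∃ c ∈ AddSubmonoid.closure (loopEffects φ T F V F.card), x = q.sum + c

lemma IsSkeleton.map_eq {V : Set H} {x : G} {q : List G} (hq : IsSkeleton φ T F h V x q) :
    φ x = φ q.sum := by
  obtain ⟨c, hc, rfl⟩ := hq.exists_loops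
  rw [map_add, map_eq_zero_of_mem_closure_loopEffects hc, add_zero]

lemma IsSkeleton.length_lt_card_mul_card {V : Set H} {x : G} {q : List G}
    (hq : IsSkeleton φ T F h V x q) : q.length < F.card * F.card := by
  refine hq.length_lt.trans_le (Nat.mul_le_mul_right _ ?_)
  rw [← Set.ncard_coe_finset F, ← hq.visited_eq]
  exact Set.ncard_le_ncard hq.isWalk.visited_subset F.finite_toSet

lemma exists_isSkeleton_singleton (hp : IsWalk φ T F h p) (hvis : visited φ h p ⊆ {h}) :
    ∃ q, IsSkeleton φ T F h {h} p.sum q := by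
  obtain ⟨r, hr, hrF, hrp, c, hc, hsum⟩ := exists_isWalk_length_lt_card hp
  refine ⟨r, hr, ?_, by simpa using hrF, c, ?_, hsum⟩
  · exact (hrp.trans hvis).antisymm (Set.singleton_subset_iff.mpr start_mem_visited)
  · exact AddSubmonoid.closure_mono (loopEffects_mono hvis _) hc

lemma IsSkeleton.exists_insert {V : Set H} {x t : G} {q s : List G}
    (hq : IsSkeleton φ T F h V x q) (ht : t ∈ T) (hnew : h + φ (x + t) ∉ V)
    (hs : IsWalk φ T F (h + φ (x + t)) s)
    (hsV : visited φ (h + φ (x + t)) s ⊆ insert (h + φ (x + t)) V) :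
    ∃ q', IsSkeleton φ T F h (insert (h + φ (x + t)) V) (x + t + s.sum) q' := by
  obtain ⟨r, hr, hrF, hrs, c', hc', hsum'⟩ := exists_isWalk_length_lt_card hs
  obtain ⟨c, hc, hsum⟩ := hq.exists_loops
  have hend : φ (q ++ [t]).sum = φ (x + t) := by simp [hq.map_eq]
  have hqt : visited φ h (q ++ [t]) = insert (h + φ (x + t)) V := by
    rw [visited_concat, hend, hq.visited_eq]
  have hVfin : V.Finite := hq.visited_eq ▸ finite_visited φ h q
  refine ⟨q ++ [t] ++ r, isWalk_append.mpr ⟨⟨?_, ?_⟩, hend ▸ hr⟩, ?_, ?_, c + c', ?_, ?_⟩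
  · simpa [or_imp, forall_and, ht] using hq.isWalk.mem
  · rw [hqt, Set.insert_subset_iff, ← hq.visited_eq]
    exact ⟨hs.visited_subset start_mem_visited, hq.isWalk.visited_subset⟩
  · rw [visited_append, hqt, hend, Set.union_eq_left]
    exact hrs.trans hsV
  · have := hq.length_lt
    rw [Set.ncard_insert_of_notMem hnew hVfin]
    simp only [List.length_append, List.length_singleton]
    lia
  · exact add_mem (AddSubmonoid.closure_mono (loopEffects_mono (Set.subset_insert _ _) _) hc)
      (AddSubmonoid.closure_mono (loopEffects_mono hsV _) hc')
  · rw [hsum, hsum', List.sum_append, List.sum_append, List.sum_singleton]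
    abel

/-- Induction on `p`: its last step `t` is passed on to `s` if it leads to an old node. -/
lemma exists_isSkeleton_append (hp : IsWalk φ T F h p) {s : List G}
    (hs : IsWalk φ T F (h + φ p.sum) s) (hsp : visited φ (h + φ p.sum) s ⊆ visited φ h p) :
    ∃ q, IsSkeleton φ T F h (visited φ h p) (p.sum + s.sum) q := by
  induction p using List.reverseRecOn generalizing s with
  | nil =>
    simp only [List.sum_nil, map_zero, add_zero, zero_add, visited_nil] at hs hsp ⊢
    exact exists_isSkeleton_singleton hs hsp
  | append_singleton p t ih =>
    have hp' := (isWalk_append.mp hp).1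
    have ht : IsWalk φ T F (h + φ p.sum) [t] := (isWalk_append.mp hp).2
    by_cases hold : h + φ (p ++ [t]).sum ∈ visited φ h p
    · rw [visited_concat, Set.insert_eq_of_mem hold] at hsp ⊢
      have hts : IsWalk φ T F (h + φ p.sum) ([t] ++ s) :=
        isWalk_append.mpr ⟨ht, by simpa [add_assoc] using hs⟩
      have hvis : visited φ (h + φ p.sum) ([t] ++ s) ⊆ visited φ h p := by
        have h₁ : visited φ (h + φ p.sum) [t] ⊆ visited φ h (p ++ [t]) := by
          rw [visited_append]
          exact Set.subset_union_right
        rw [visited_concat, Set.insert_eq_of_mem hold] at h₁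
        rw [visited_append]
        exact Set.union_subset h₁ (by simpa [add_assoc] using hsp)
      simpa [add_assoc] using ih hp' hts hvis
    · obtain ⟨q, hq⟩ := ih hp' (s := [])
        (isWalk_nil.mpr (hp'.visited_subset end_mem_visited))
        (by simpa only [visited_nil, Set.singleton_subset_iff] using end_mem_visited)
      rw [visited_concat] at hsp ⊢
      simp only [List.sum_append, List.sum_singleton, List.sum_nil, add_zero] at hq hs hsp hold ⊢
      exact hq.exists_insert (ht.mem t (List.mem_singleton_self t)) hold hs hsp

lemma exists_isSkeleton (hp : IsWalk φ T F h p) :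
    ∃ q, IsSkeleton φ T F h (visited φ h p) p.sum q := by
  simpa using exists_isSkeleton_append hp (s := [])
    (isWalk_nil.mpr (hp.visited_subset end_mem_visited))
    (by simpa only [visited_nil, Set.singleton_subset_iff] using end_mem_visited)

end Skeletons

section Insertion

variable {G H : Type*} [AddCommGroup G] [AddCommGroup H] {φ : G →+ H} {T : Set G} {F : Set H}
  {h : H} {p q : List G}

lemma IsWalk.exists_insert_loop (hq : IsWalk φ T F h q) {N : ℕ} {e : G}
    (he : e ∈ loopEffects φ T F (visited φ h q) N) :
    ∃ q', IsWalk φ T F h q' ∧ visited φ h q ⊆ visited φ h q' ∧ q'.sum = q.sum + e ∧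
      q'.length ≤ q.length + N := by
  obtain ⟨_, ⟨a, ⟨b, rfl⟩, rfl⟩, l, hl, hφ, hlN, rfl⟩ := he
  refine ⟨a ++ l ++ b, ?_, ?_, ?_, ?_⟩
  · simp only [isWalk_append, List.sum_append, map_add, hφ, add_zero] at hq ⊢
    exact ⟨⟨hq.1, hl⟩, hq.2⟩
  · simp only [visited_append, List.sum_append, map_add, hφ, add_zero]
    grind
  · simp only [List.sum_append]
    abel
  · simp only [List.length_append]
    lia

lemma IsWalk.exists_insert_loops (hq : IsWalk φ T F h q) {N : ℕ} {M : Multiset G}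
    (hM : ∀ e ∈ M, e ∈ loopEffects φ T F (visited φ h q) N) :
    ∃ q', IsWalk φ T F h q' ∧ q'.sum = q.sum + M.sum ∧ q'.length ≤ q.length + M.card * N := by
  induction M using Multiset.induction_on generalizing q with
  | empty => exact ⟨q, hq, by simp, by simp⟩
  | cons e M ih =>
    rw [Multiset.forall_mem_cons] at hM
    obtain ⟨r, hr, hqr, hrsum, hrlen⟩ := hq.exists_insert_loop hM.1
    obtain ⟨q', hq', hsum, hlen⟩ := ih hr fun e he => loopEffects_mono hqr N (hM.2 e he)
    refine ⟨q', hq', ?_, ?_⟩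
    · rw [hsum, hrsum, Multiset.sum_cons, add_assoc]
    · rw [Multiset.card_cons, add_one_mul]
      lia

end Insertion

section Rays

/-- `S` is a union of singletons and rays whose apices are bounded by `R`: each `e ∈ S` is of the
form `a + σ * s` for a progression of step `σ ∈ {-1, 0, 1}` that starts at `a` and stays in `S`. -/
def IsRayUnion (R : ℕ) (S : Set ℤ) : Prop :=
  ∀ e ∈ S, ∃ a σ : ℤ, a.natAbs ≤ R ∧ σ.natAbs ≤ 1 ∧ (∃ s : ℕ, e = a + σ * s) ∧
    ∀ s : ℕ, a + σ * s ∈ S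

lemma isRayUnion_univ (R : ℕ) : IsRayUnion R Set.univ := fun e _ =>
  ⟨0, e.sign, by simp, by rcases Int.sign_trichotomy e with h | h | h <;> simp [h],
    ⟨e.natAbs, by rw [zero_add, Int.sign_mul_natAbs]⟩, fun _ => trivial⟩

variable {ι κ : Type*} [Fintype ι] [Fintype κ] {J : ι → Set ℤ} {D R U : ℕ} {u : ι → ℤ}

lemma exists_small_mulVec_mem (hJ : ∀ i, IsRayUnion R (J i)) (hu : ∀ i, (u i).natAbs ≤ U)
    (hD : 1 ≤ D) (B : Matrix ι κ ℤ) (hB : ∀ i k, (B i k).natAbs ≤ D) (x : κ → ℕ)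
    (hx : ∀ i, u i + (B *ᵥ fun k => (x k : ℤ)) i ∈ J i) :
    ∃ z : κ → ℕ, (∀ i, u i + (B *ᵥ fun k => (z k : ℤ)) i ∈ J i) ∧
      ∀ k, z k ≤ solutionBound (Fintype.card ι) (Fintype.card κ + Fintype.card ι) D (R + U) := by
  classical
  choose a σ ha hσ hs hmem using fun i => hJ i _ (hx i)
  choose s hs using hs
  let A : Matrix ι (κ ⊕ ι) ℤ := Matrix.fromCols B (Matrix.diagonal (-σ))
  have hA : ∀ (w : κ ⊕ ι → ℕ) i, (A *ᵥ fun k => (w k : ℤ)) i =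
      (B *ᵥ fun k => (w (Sum.inl k) : ℤ)) i - σ i * w (Sum.inr i) := by
    intro w i
    simp [A, Matrix.fromCols_mulVec, Matrix.mulVec_diagonal, Function.comp_def, sub_eq_add_neg]
  have hAx : ∀ i, (A *ᵥ fun k => ((Sum.elim x s : κ ⊕ ι → ℕ) k : ℤ)) i = a i - u i := by
    intro i
    rw [hA]
    simp only [Sum.elim_inl, Sum.elim_inr]
    linarith [hs i]
  obtain ⟨z, hz, hzle⟩ := exists_small_solution A (N := D) (R := R + U) hD
    (fun i k => by
      rcases k with k | k
      · exact hB i k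
      · by_cases hik : i = k
        · simpa [A, hik] using (hσ k).trans hD
        · simp [A, hik])
    (Sum.elim x s) (fun i => by grind)
  refine ⟨fun k => z (Sum.inl k), fun i => ?_, fun k => ?_⟩
  · have hzi := congrFun hz i
    rw [hA, hAx] at hzi
    convert hmem i (z (Sum.inr i)) using 1
    linarith
  · simpa using hzle (Sum.inl k)

lemma exists_finset_eq_of_natAbs_le {E : Set (ι → ℤ)} (hE : ∀ e ∈ E, ∀ i, (e i).natAbs ≤ D) :
    ∃ E' : Finset (ι → ℤ), ↑E' = E ∧ E'.card ≤ (2 * D + 1) ^ Fintype.card ι := by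
  classical
  let box : Finset (ι → ℤ) := Fintype.piFinset fun _ => Finset.Icc (-(D : ℤ)) D
  have hsub : E ⊆ box := by
    intro e he
    simp only [box, Finset.mem_coe, Fintype.mem_piFinset, Finset.mem_Icc]
    intro i
    have := hE e he i
    lia
  obtain ⟨E', rfl⟩ := (box.finite_toSet.subset hsub).exists_finset_coe
  refine ⟨E', rfl, (Finset.card_le_card (Finset.coe_subset.mp hsub)).trans_eq ?_⟩
  rw [Fintype.card_piFinset, Finset.prod_const, Int.card_Icc, Finset.card_univ]
  congr 1
  lia

lemma exists_small_multiset_sum_mem (hJ : ∀ i, IsRayUnion R (J i)) (hu : ∀ i, (u i).natAbs ≤ U)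
    (hD : 1 ≤ D) {E : Set (ι → ℤ)} (hE : ∀ e ∈ E, ∀ i, (e i).natAbs ≤ D) {c : ι → ℤ}
    (hc : c ∈ AddSubmonoid.closure E) (hcJ : ∀ i, u i + c i ∈ J i) :
    ∃ M : Multiset (ι → ℤ), (∀ e ∈ M, e ∈ E) ∧ (∀ i, u i + M.sum i ∈ J i) ∧
      M.card ≤ (2 * D + 1) ^ Fintype.card ι * solutionBound (Fintype.card ι)
        ((2 * D + 1) ^ Fintype.card ι + Fintype.card ι) D (R + U) := by
  obtain ⟨E, rfl, hcard⟩ := exists_finset_eq_of_natAbs_le hE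
  let B : Matrix ι E ℤ := fun i e => e.1 i
  have hB : ∀ (w : E → ℕ) i, (∑ e : E, w e • e.1) i = (B *ᵥ fun e => (w e : ℤ)) i := fun w i => by
    simp [B, Matrix.mulVec, dotProduct, Finset.sum_apply, mul_comm]
  obtain ⟨x, rfl⟩ := AddSubmonoid.mem_closure_finset'.mp hc
  obtain ⟨z, hz, hzle⟩ := exists_small_mulVec_mem hJ hu hD B (fun i e => hE e e.2 i) x
    (fun i => hB x i ▸ hcJ i)
  refine ⟨∑ e : E, Multiset.replicate (z e) e.1, fun e he => ?_, fun i => ?_, ?_⟩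
  · obtain ⟨e', -, he'⟩ := Multiset.mem_sum.mp he
    exact Multiset.eq_of_mem_replicate he' ▸ e'.2
  · simp only [Multiset.sum_sum, Multiset.sum_replicate, hB]
    exact hz i
  · rw [Fintype.card_coe] at hzle
    simp only [Multiset.card_sum, Multiset.card_replicate]
    refine (Finset.sum_le_card_nsmul _ _ _ fun e _ => hzle e).trans ?_
    rw [Finset.card_univ, Fintype.card_coe, smul_eq_mul]
    gcongr
    exact solutionBound_mono _ _ _ (by gcongr)

end Rays

section ShortWalk

variable {ι H : Type*} [AddCommGroup H] {φ : (ι → ℤ) →+ H} {T : Set (ι → ℤ)} {N Δ R : ℕ}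

lemma natAbs_list_sum_le (hΔ : ∀ t ∈ T, ∀ i, (t i).natAbs ≤ Δ) {p : List (ι → ℤ)}
    (hp : ∀ t ∈ p, t ∈ T) (i : ι) : (p.sum i).natAbs ≤ p.length * Δ := by
  induction p with
  | nil => simp
  | cons t p ih =>
    rw [List.forall_mem_cons] at hp
    have h₁ := hΔ t hp.1 i
    have h₂ := ih hp.2
    rw [List.sum_cons, Pi.add_apply, List.length_cons, add_one_mul]
    lia

/-- The bound on the length of a walk in `N` nodes that is obtained by cutting out all loops and
inserting few of them again. -/
def walkBound (n N Δ R : ℕ) : ℕ :=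
  N * N + (2 * (N * Δ) + 1) ^ n *
    solutionBound n ((2 * (N * Δ) + 1) ^ n + n) (N * Δ) (R + N * N * Δ) * N

lemma exists_short_walk [Fintype ι] (hΔ1 : 1 ≤ Δ) (hΔ : ∀ t ∈ T, ∀ i, (t i).natAbs ≤ Δ)
    {F : Finset H} (hN : F.card ≤ N) {h : H} {p : List (ι → ℤ)} (hp : IsWalk φ T F h p)
    {J : ι → Set ℤ} (hJ : ∀ i, IsRayUnion R (J i)) (hpJ : ∀ i, p.sum i ∈ J i) :
    ∃ q, IsWalk φ T F h q ∧ φ q.sum = φ p.sum ∧ (∀ i, q.sum i ∈ J i) ∧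
      q.length ≤ walkBound (Fintype.card ι) N Δ R := by
  obtain ⟨q, hq⟩ := exists_isSkeleton hp
  obtain ⟨c, hc, hsum⟩ := hq.exists_loops
  have hN1 : 1 ≤ N := hN.trans' (Finset.card_pos.mpr ⟨h, hp.visited_subset start_mem_visited⟩)
  have hqlen : q.length ≤ N * N := hq.length_lt_card_mul_card.le.trans (Nat.mul_le_mul hN hN)
  have hloops : ∀ e ∈ loopEffects φ T F (visited φ h p) F.card, ∀ i, (e i).natAbs ≤ N * Δ := by
    rintro _ ⟨x, -, l, hl, -, hlen, rfl⟩ i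
    exact (natAbs_list_sum_le hΔ hl.mem i).trans (Nat.mul_le_mul_right _ (hlen.trans hN))
  obtain ⟨M, hM, hMJ, hMcard⟩ := exists_small_multiset_sum_mem hJ (u := q.sum) (U := N * N * Δ)
    (fun i => (natAbs_list_sum_le hΔ hq.isWalk.mem i).trans (Nat.mul_le_mul_right _ hqlen))
    (Nat.mul_pos hN1 hΔ1) hloops hc (fun i => by simpa [hsum] using hpJ i)
  obtain ⟨r, hr, hrsum, hrlen⟩ := hq.isWalk.exists_insert_loops (hq.visited_eq ▸ hM)
  have hMφ : φ M.sum = 0 := map_eq_zero_of_mem_closure_loopEffects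
    (AddSubmonoid.multiset_sum_mem _ M fun e he => AddSubmonoid.subset_closure (hM e he))
  refine ⟨r, hr, ?_, fun i => ?_, ?_⟩
  · rw [hrsum, map_add, hMφ, add_zero, hq.map_eq]
  · rw [hrsum]
    exact hMJ i
  · rw [walkBound]
    exact hrlen.trans (Nat.add_le_add hqlen (Nat.mul_le_mul hMcard hN))

end ShortWalk

section SafePaths

variable {ι : Type*} {T : Set (ι → ℤ)} {A A' : Finset ι} {v w : ι → ℤ} {p q : List (ι → ℤ)}

/-- The path `p` with steps in `T` that starts at `v` keeps the coordinates in `A` nonnegative. -/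
abbrev IsSafe (T : Set (ι → ℤ)) (A : Finset ι) (v : ι → ℤ) (p : List (ι → ℤ)) : Prop :=
  IsWalk (AddMonoidHom.id (ι → ℤ)) T {x | ∀ i ∈ A, 0 ≤ x i} v p

/-- The path `p` with steps in `T` that starts at `v` keeps the coordinates in `A` nonnegative and
smaller than `b`. -/
abbrev IsBounded (T : Set (ι → ℤ)) (A : Finset ι) (b : ℕ) (v : ι → ℤ) (p : List (ι → ℤ)) : Prop :=
  IsWalk (AddMonoidHom.id (ι → ℤ)) T {x | ∀ i ∈ A, 0 ≤ x i ∧ x i < b} v p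

lemma IsBounded.isSafe {b : ℕ} (hp : IsBounded T A b v p) : IsSafe T A v p :=
  hp.mono fun _ hx i hi => (hx i hi).1

lemma isSafe_append : IsSafe T A v (p ++ q) ↔ IsSafe T A v p ∧ IsSafe T A (v + p.sum) q :=
  isWalk_append

lemma IsSafe.mono (hp : IsSafe T A v p) (hA : A' ⊆ A) (hvw : ∀ i ∈ A', v i ≤ w i) :
    IsSafe T A' w p := by
  refine ⟨hp.mem, ?_⟩
  rintro _ ⟨q, hq, rfl⟩ i hi
  have := hp.visited_subset ⟨q, hq, rfl⟩ i (hA hi)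
  simp only [AddMonoidHom.id_apply, Pi.add_apply] at this ⊢
  linarith [hvw i hi]

lemma neg_le_list_sum {d : ℕ} (hd : ∀ t ∈ T, ∀ i, -(d : ℤ) ≤ t i) (hp : ∀ t ∈ p, t ∈ T) (i : ι) :
    -((d * p.length : ℕ) : ℤ) ≤ p.sum i := by
  induction p with
  | nil => simp
  | cons t p ih =>
    rw [List.forall_mem_cons] at hp
    have h₁ := hd t hp.1 i
    have h₂ := ih hp.2
    rw [List.sum_cons, Pi.add_apply, List.length_cons, mul_add_one]
    lia

lemma IsSafe.of_erase [DecidableEq ι] {d : ℕ} (hd : ∀ t ∈ T, ∀ i, -(d : ℤ) ≤ t i) {i : ι}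
    (hp : IsSafe T (A.erase i) v p) (hv : ((d * p.length : ℕ) : ℤ) ≤ v i) : IsSafe T A v p := by
  refine ⟨hp.mem, ?_⟩
  rintro _ ⟨q, hq, rfl⟩ k hk
  by_cases hki : k = i
  · subst hki
    have h₁ := neg_le_list_sum hd (fun t ht => hp.mem t (hq.subset ht)) k
    have h₂ : d * q.length ≤ d * p.length := Nat.mul_le_mul_left d hq.length_le
    rw [AddMonoidHom.id_apply, Pi.add_apply]
    lia
  · exact hp.visited_subset ⟨q, hq, rfl⟩ k (Finset.mem_erase.mpr ⟨hki, hk⟩)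

variable [Fintype ι] {Δ R b : ℕ}

lemma IsBounded.exists_short (hp : IsBounded T A b v p) (hb : 1 ≤ b) (hΔ1 : 1 ≤ Δ)
    (hΔ : ∀ t ∈ T, ∀ i, (t i).natAbs ≤ Δ) {J : ι → Set ℤ} (hJ : ∀ i, IsRayUnion R (J i))
    (hpJ : ∀ i, p.sum i ∈ J i) :
    ∃ q, IsSafe T A v q ∧ (∀ i ∈ A, q.sum i = p.sum i) ∧ (∀ i, q.sum i ∈ J i) ∧
      q.length ≤ walkBound (Fintype.card ι) (b ^ Fintype.card ι) Δ R := by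
  classical
  let φ : (ι → ℤ) →+ (A → ℤ) := AddMonoidHom.pi fun i => Pi.evalAddMonoidHom _ i.1
  let F : Finset (A → ℤ) := Fintype.piFinset fun _ => Finset.Ico 0 (b : ℤ)
  have hFcard : F.card ≤ b ^ Fintype.card ι := by
    rw [Fintype.card_piFinset, Finset.prod_const, Int.card_Ico, Finset.card_univ, sub_zero,
      Int.toNat_natCast, Fintype.card_coe]
    exact Nat.pow_le_pow_right hb (Finset.card_le_univ A)
  have hF : φ ⁻¹' F = {x | ∀ i ∈ A, 0 ≤ x i ∧ x i < (b : ℤ)} := by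
    ext x
    simp [φ, F]
  obtain ⟨q, hq, hφ, hqJ, hqlen⟩ :=
    exists_short_walk hΔ1 hΔ hFcard (isWalk_map.mpr (by rwa [hF])) hJ hpJ
  refine ⟨q, ?_, fun i hi => congrFun hφ ⟨i, hi⟩, hqJ, hqlen⟩
  rw [isWalk_map, hF] at hq
  exact IsBounded.isSafe hq

end SafePaths

section Segments

variable {ι : Type*}

variable (ι) in
/-- A segment of a path is to keep the coordinates in `coords` nonnegative and to end with a part
whose effect has its `i`-th coordinate in `target i`. -/
structure Segment where
  coords : Finset ι
  target : ι → Set ℤ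

/-- The effects of the segment are nonnegative on the coordinates that have to be nonnegative, and
they are described by integers of absolute value at most `R`. -/
structure Segment.IsAdmissible (R : ℕ) (s : Segment ι) : Prop where
  isRayUnion : ∀ i, IsRayUnion R (s.target i)
  nonneg : ∀ i ∈ s.coords, ∀ e ∈ s.target i, 0 ≤ e

/-- A list of segments that can be solved one after the other, where no segment adds to the
coordinates that have to be nonnegative. -/
structure WellFormed (R : ℕ) (S : List (Segment ι)) : Prop where
  isAdmissible : ∀ s ∈ S, s.IsAdmissible R
  pairwise : S.Pairwise fun s s' => s'.coords ⊆ s.coords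

/-- There are consecutive paths from `v`, of total length `m` and with steps in `T`, that solve the
segments in the list. -/
inductive HasSolution (T : Set (ι → ℤ)) : List (Segment ι) → (ι → ℤ) → ℕ → Prop
  | nil (v : ι → ℤ) : HasSolution T [] v 0
  | cons {s : Segment ι} {S : List (Segment ι)} {v : ι → ℤ} {m : ℕ} (p q : List (ι → ℤ)) :
    IsSafe T s.coords v (p ++ q) → (∀ i, q.sum i ∈ s.target i) →
    HasSolution T S (v + (p ++ q).sum) m → HasSolution T (s :: S) v ((p ++ q).length + m)

variable {T : Set (ι → ℤ)} {s : Segment ι} {S : List (Segment ι)} {v w : ι → ℤ} {m R : ℕ}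

lemma WellFormed.head (h : WellFormed R (s :: S)) : s.IsAdmissible R :=
  h.isAdmissible s List.mem_cons_self

lemma WellFormed.tail (h : WellFormed R (s :: S)) : WellFormed R S :=
  ⟨fun s' hs' => h.isAdmissible s' (List.mem_cons_of_mem s hs'), h.pairwise.of_cons⟩

lemma WellFormed.coords_subset (h : WellFormed R (s :: S)) {s' : Segment ι} (hs' : s' ∈ S) :
    s'.coords ⊆ s.coords :=
  List.rel_of_pairwise_cons h.pairwise hs'

lemma HasSolution.mono (h : HasSolution T S v m) (hvw : ∀ s ∈ S, ∀ i ∈ s.coords, v i ≤ w i) :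
    HasSolution T S w m := by
  induction h generalizing w with
  | nil => exact .nil w
  | cons p q hs hq _ ih =>
    rw [List.forall_mem_cons] at hvw
    exact .cons p q (hs.mono subset_rfl hvw.1) hq
      (ih fun s hs i hi => add_le_add_left (hvw.2 s hs i hi) _)

lemma HasSolution.prepend {r : List (ι → ℤ)} (h : HasSolution T (s :: S) (v + r.sum) m)
    (hr : IsSafe T s.coords v r) : HasSolution T (s :: S) v (r.length + m) := by
  cases h with
  | @cons _ _ _ m p q hs hq hrest =>
    have := HasSolution.cons (s := s) (S := S) (v := v) (m := m) (r ++ p) q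
      (by rw [List.append_assoc, isSafe_append]; exact ⟨hr, hs⟩) hq
      (by rwa [List.append_assoc, List.sum_append, ← add_assoc])
    rwa [List.append_assoc, List.length_append, add_assoc] at this

/-- The walk is completed to one for the whole segment, and the part with effect in the target is
then repeated: as its effect is nonnegative, this is safe and does no harm to the later segments. -/
lemma WellFormed.exists_hasSolution_of_prefix (hS : WellFormed R (s :: S)) {p q p₁ : List (ι → ℤ)}
    (hpq : IsSafe T s.coords v (p ++ q)) (hq : ∀ i, q.sum i ∈ s.target i)
    (hrest : HasSolution T S (v + (p ++ q).sum) m) (hp₁ : p₁ <+: p ++ q) :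
    ∃ m', HasSolution T (s :: S) (v + p₁.sum) m' := by
  obtain ⟨p₂, hp₂⟩ := hp₁
  have hsum : v + p₁.sum + p₂.sum = v + (p ++ q).sum := by
    rw [← hp₂, List.sum_append, add_assoc]
  have hnonneg : ∀ i ∈ s.coords, 0 ≤ q.sum i := fun i hi => hS.head.nonneg i hi _ (hq i)
  refine ⟨_, .cons p₂ q ?_ hq (hrest.mono fun s' hs' i hi => ?_)⟩
  · rw [isSafe_append, hsum]
    refine ⟨(isSafe_append.mp (hp₂ ▸ hpq)).2, (isSafe_append.mp hpq).2.mono subset_rfl ?_⟩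
    intro i hi
    simpa using hnonneg i hi
  · rw [List.sum_append (l₁ := p₂), ← add_assoc, hsum]
    simpa using hnonneg i (hS.coords_subset hs' hi)

section Erase

variable [DecidableEq ι] {i : ι}

/-- Drop the requirement that the coordinate `i` be nonnegative from a list of segments. -/
def eraseCoord (i : ι) (S : List (Segment ι)) : List (Segment ι) :=
  S.map fun s => ⟨s.coords.erase i, s.target⟩

lemma WellFormed.eraseCoord (h : WellFormed R S) (i : ι) : WellFormed R (eraseCoord i S) where
  isAdmissible := List.forall_mem_map.mpr fun s hs =>
    ⟨(h.isAdmissible s hs).isRayUnion,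
      fun k hk => (h.isAdmissible s hs).nonneg k (Finset.mem_of_mem_erase hk)⟩
  pairwise := List.pairwise_map.mpr (h.pairwise.imp (Finset.erase_subset_erase i))

lemma HasSolution.eraseCoord (h : HasSolution T S v m) (i : ι) :
    HasSolution T (eraseCoord i S) v m := by
  induction h with
  | nil => exact .nil _
  | cons p q hs hq _ ih =>
    exact .cons p q (hs.mono (Finset.erase_subset _ _) fun _ _ => le_rfl) hq ih

lemma HasSolution.of_eraseCoord {d : ℕ} (hd : ∀ t ∈ T, ∀ i, -(d : ℤ) ≤ t i)
    (h : HasSolution T (GenUnbound.eraseCoord i S) v m) (hv : ((d * m : ℕ) : ℤ) ≤ v i) :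
    HasSolution T S v m := by
  induction S generalizing v m with
  | nil => exact h
  | cons s S ih =>
    cases h with
    | @cons _ _ _ m p q hs hq hrest =>
      rw [mul_add] at hv
      refine .cons p q (hs.of_erase hd (by lia)) hq (ih hrest ?_)
      have := neg_le_list_sum hd hs.mem i
      rw [Pi.add_apply]
      lia

end Erase

end Segments

section ShortSolutions

variable {ι : Type*} {T : Set (ι → ℤ)} {s : Segment ι} {S : List (Segment ι)}
  {v : ι → ℤ} {b m c d Δ R K L : ℕ}

/-- Every solvable list of at most `K` segments, each with fewer than `c` nonnegative coordinates,
has a solution of length at most `L`. -/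
def ShortSolutions (T : Set (ι → ℤ)) (R K c L : ℕ) : Prop :=
  ∀ (S : List (Segment ι)) (v : ι → ℤ) (m : ℕ), WellFormed R S → (∀ s ∈ S, s.coords.card < c) →
    S.length ≤ K → HasSolution T S v m → ∃ m' ≤ L, HasSolution T S v m'

lemma ShortSolutions.mono {L' : ℕ} (hL : ShortSolutions T R K c L) (h : L ≤ L') :
    ShortSolutions T R K c L' := fun S v m hS hc hK hsol =>
  (hL S v m hS hc hK hsol).imp fun _ => And.imp_left h.trans'

lemma ShortSolutions.exists_of_le (hL : ShortSolutions T R K c L)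
    (hd : ∀ t ∈ T, ∀ i, -(d : ℤ) ≤ t i) (hS : WellFormed R (s :: S)) (hc : s.coords.card ≤ c)
    (hK : (s :: S).length ≤ K) (h : HasSolution T (s :: S) v m) {i : ι} (hi : i ∈ s.coords)
    (hv : ((d * L : ℕ) : ℤ) ≤ v i) : ∃ m' ≤ L, HasSolution T (s :: S) v m' := by
  classical
  have hcard : ∀ s' ∈ s :: S, (s'.coords.erase i).card < c := fun s' hs' => by
    have hsub : s'.coords ⊆ s.coords :=
      (List.mem_cons.mp hs').elim (fun h => h ▸ subset_rfl) hS.coords_subset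
    exact ((Finset.card_le_card (Finset.erase_subset_erase i hsub)).trans_lt
      (Finset.card_erase_lt_of_mem hi)).trans_le hc
  obtain ⟨m', hm', h'⟩ := hL _ v m (hS.eraseCoord i) (List.forall_mem_map.mpr hcard)
    (by simpa [eraseCoord] using hK) (h.eraseCoord i)
  have hdm : ((d * m' : ℕ) : ℤ) ≤ (d * L : ℕ) := by exact_mod_cast Nat.mul_le_mul_left d hm'
  exact ⟨m', hm', h'.of_eraseCoord hd (hdm.trans hv)⟩

variable [Fintype ι]

lemma Segment.IsAdmissible.exists_short (hs : s.IsAdmissible R) (hΔ1 : 1 ≤ Δ)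
    (hΔ : ∀ t ∈ T, ∀ i, (t i).natAbs ≤ Δ) (hb : 1 ≤ b) {p q : List (ι → ℤ)}
    (hpq : IsBounded T s.coords b v (p ++ q)) (hq : ∀ i, q.sum i ∈ s.target i) :
    ∃ p' q', IsSafe T s.coords v (p' ++ q') ∧ (∀ i, q'.sum i ∈ s.target i) ∧
      (∀ i ∈ s.coords, (p' ++ q').sum i = (p ++ q).sum i) ∧
      (p' ++ q').length ≤ 2 * walkBound (Fintype.card ι) (b ^ Fintype.card ι) Δ R := by
  obtain ⟨hpb, hqb⟩ := isWalk_append.mp hpq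
  obtain ⟨p', hp', hp'eq, -, hp'len⟩ := IsBounded.exists_short hpb hb hΔ1 hΔ
    (fun _ => isRayUnion_univ R) fun _ => Set.mem_univ _
  obtain ⟨q', hq', hq'eq, hq'target, hq'len⟩ :=
    IsBounded.exists_short hqb hb hΔ1 hΔ hs.isRayUnion hq
  refine ⟨p', q', isSafe_append.mpr ⟨hp', ?_⟩, hq'target, ?_, ?_⟩
  · exact hq'.mono subset_rfl fun i hi => by simp [hp'eq i hi]
  · exact fun i hi => by simp [hp'eq i hi, hq'eq i hi]
  · rw [List.length_append]
    lia

lemma IsSafe.exists_short_exit {A : Finset ι} {p : List (ι → ℤ)} (hp : IsSafe T A v p)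
    (hΔ1 : 1 ≤ Δ) (hΔ : ∀ t ∈ T, ∀ i, (t i).natAbs ≤ Δ) (hb : 1 ≤ b)
    (hexit : ∀ r t, p = r ++ [t] → IsBounded T A b v r) :
    ∃ q, IsSafe T A v q ∧ (∀ i ∈ A, q.sum i = p.sum i) ∧
      q.length ≤ walkBound (Fintype.card ι) (b ^ Fintype.card ι) Δ R + 1 := by
  rcases List.eq_nil_or_concat' p with rfl | ⟨r, t, rfl⟩
  · exact ⟨[], hp, fun _ _ => rfl, by simp⟩
  obtain ⟨q, hq, hqr, -, hqlen⟩ := (hexit r t rfl).exists_short hb hΔ1 hΔ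
    (fun _ => isRayUnion_univ R) fun _ => Set.mem_univ _
  refine ⟨q ++ [t], isSafe_append.mpr ⟨hq, ?_⟩, fun i hi => by simp [hqr i hi], ?_⟩
  · exact (isSafe_append.mp hp).2.mono subset_rfl fun i hi => by simp [hqr i hi]
  · simpa using hqlen

lemma ShortSolutions.exists_of_exit (hL : ShortSolutions T R K c L)
    (hΔ1 : 1 ≤ Δ) (hΔ : ∀ t ∈ T, ∀ i, (t i).natAbs ≤ Δ) (hb : 1 ≤ d * L)
    (hd : ∀ t ∈ T, ∀ i, -(d : ℤ) ≤ t i) (hS : WellFormed R (s :: S)) (hc : s.coords.card ≤ c)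
    (hK : (s :: S).length ≤ K) {p : List (ι → ℤ)} (hp : IsSafe T s.coords v p)
    (hout : ¬ ∀ i ∈ s.coords, 0 ≤ (v + p.sum) i ∧ (v + p.sum) i < (d * L : ℕ))
    (hexit : ∀ r t, p = r ++ [t] → IsBounded T s.coords (d * L) v r)
    (h : HasSolution T (s :: S) (v + p.sum) m) :
    ∃ m' ≤ walkBound (Fintype.card ι) ((d * L) ^ Fintype.card ι) Δ R + 1 + L,
      HasSolution T (s :: S) v m' := by
  obtain ⟨q, hq, hqp, hqlen⟩ := hp.exists_short_exit (R := R) hΔ1 hΔ hb hexit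
  have hmono : HasSolution T (s :: S) (v + q.sum) m := by
    refine h.mono (List.forall_mem_cons.mpr ⟨fun i hi => ?_, fun s' hs' i hi => ?_⟩)
    · simp [hqp i hi]
    · simp [hqp i (hS.coords_subset hs' hi)]
  obtain ⟨i, hi, hiL⟩ : ∃ i ∈ s.coords, ((d * L : ℕ) : ℤ) ≤ (v + p.sum) i := by
    have hnonneg := hp.visited_subset end_mem_visited
    by_contra! hlt
    exact hout fun i hi => ⟨hnonneg i hi, hlt i hi⟩
  obtain ⟨m', hm', h'⟩ := hL.exists_of_le hd hS hc hK hmono hi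
    (by simpa [hqp i hi] using hiL)
  exact ⟨_, Nat.add_le_add hqlen hm', h'.prepend hq⟩

/-- Rackoff's argument: as long as all coordinates remain below `d * L`, the paths are replaced by
short ones; as soon as one of them reaches `d * L`, it can be ignored during the `L` remaining
steps. -/
lemma ShortSolutions.exists_succ (hL : ShortSolutions T R K c L)
    (hΔ1 : 1 ≤ Δ) (hΔ : ∀ t ∈ T, ∀ i, (t i).natAbs ≤ Δ) (hb : 1 ≤ d * L)
    (hd : ∀ t ∈ T, ∀ i, -(d : ℤ) ≤ t i) (hS : WellFormed R S) (hc : ∀ s ∈ S, s.coords.card ≤ c)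
    (hK : S.length ≤ K) (h : HasSolution T S v m) :
    ∃ m' ≤ S.length * (2 * walkBound (Fintype.card ι) ((d * L) ^ Fintype.card ι) Δ R + 1) + L,
      HasSolution T S v m' := by
  induction S generalizing v m with
  | nil => cases h; exact ⟨0, Nat.zero_le _, .nil v⟩
  | cons s S ih =>
    cases h with | @cons _ _ _ m p q hpq hq hrest => ?_
    rw [List.forall_mem_cons] at hc
    simp only [List.length_cons, add_one_mul]
    rcases isWalk_or_exists_first_exit (φ := AddMonoidHom.id (ι → ℤ)) (h := v) hpq.mem
      {x | ∀ i ∈ s.coords, 0 ≤ x i ∧ x i < (d * L : ℕ)} with hbd | ⟨p₁, hp₁, hout, hexit⟩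
    · obtain ⟨p', q', hpq', hq', heq, hlen⟩ := hS.head.exists_short hΔ1 hΔ hb hbd hq
      have hrest' : HasSolution T S (v + (p' ++ q').sum) m := hrest.mono fun s' hs' i hi => by
        simp only [Pi.add_apply, heq i (hS.coords_subset hs' hi), le_refl]
      obtain ⟨m', hm', h'⟩ := ih hS.tail hc.2 (Nat.le_of_succ_le hK) hrest'
      exact ⟨_, by lia, .cons p' q' hpq' hq' h'⟩
    · obtain ⟨_, hsol⟩ := hS.exists_hasSolution_of_prefix hpq hq hrest hp₁
      have hsafe : IsSafe T s.coords v p₁ := by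
        obtain ⟨p₂, hp₂⟩ := hp₁
        exact (isSafe_append.mp (hp₂ ▸ hpq)).1
      obtain ⟨m', hm', h'⟩ :=
        hL.exists_of_exit hΔ1 hΔ hb hd hS hc.1 hK hsafe hout hexit hsol
      exact ⟨m', by lia, h'⟩

lemma ShortSolutions.succ (hL : ShortSolutions T R K c L)
    (hΔ1 : 1 ≤ Δ) (hΔ : ∀ t ∈ T, ∀ i, (t i).natAbs ≤ Δ) (hb : 1 ≤ d * L)
    (hd : ∀ t ∈ T, ∀ i, -(d : ℤ) ≤ t i) :
    ShortSolutions T R K (c + 1)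
      (K * (2 * walkBound (Fintype.card ι) ((d * L) ^ Fintype.card ι) Δ R + 1) + L) := by
  intro S v m hS hc hK h
  obtain ⟨m', hm', h'⟩ :=
    hL.exists_succ hΔ1 hΔ hb hd hS (fun s hs => Nat.le_of_lt_succ (hc s hs)) hK h
  exact ⟨m', hm'.trans (by gcongr), h'⟩

end ShortSolutions

section Bounds

variable {n m K N L R X B a k d e Δ : ℕ}

lemma kerBound_le_pow (hn : n + 1 ≤ X) (hN : N ≤ X ^ k) : kerBound n N ≤ X ^ ((k + 1) * n) := by
  rw [kerBound, pow_mul, pow_succ']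
  gcongr

lemma solutionBound_le_pow (hX : 4 ≤ X) (hn : n + 1 ≤ X) (hm : m ≤ X ^ a) (hN : N ≤ X ^ k)
    (hR : R ≤ X ^ (a + k + (k + 1) * n)) :
    solutionBound n m N R ≤ X ^ ((a + k + (k + 1) * n + 2) * n) := by
  refine kerBound_le_pow hn ?_
  have hprod : m * (N * kerBound n N) ≤ X ^ (a + k + (k + 1) * n) := by
    rw [add_assoc, pow_add, pow_add]
    gcongr
    exact kerBound_le_pow hn hN
  have hN' : N ≤ X ^ (a + k + (k + 1) * n) :=
    hN.trans (Nat.pow_le_pow_right (by lia) (by lia))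
  calc R + m * (N * kerBound n N) + N ≤ 4 * X ^ (a + k + (k + 1) * n) := by lia
    _ ≤ X ^ (a + k + (k + 1) * n + 1) := by rw [pow_succ']; gcongr

lemma walkBound_le_pow (hX : 4 ≤ X) (hn : n + 1 ≤ X) (hN : N ≤ X) (hΔ : Δ ≤ X) (hR : R ≤ X) :
    walkBound n N Δ R ≤ X ^ (6 * n ^ 2 + 9 * n + 3) := by
  have hpos : ∀ i, 0 < X ^ i := fun i => Nat.pow_pos (by lia)
  have four_mul_le : ∀ i, 4 * X ^ i ≤ X ^ (i + 1) := fun i => by rw [pow_succ']; gcongr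
  have hNΔ : N * Δ ≤ X ^ 2 := by rw [pow_two]; gcongr
  have hvalues : (2 * (N * Δ) + 1) ^ n ≤ X ^ (3 * n) := by
    rw [pow_mul]
    gcongr
    have := four_mul_le 2
    have := hpos 2
    lia
  have hrows : (2 * (N * Δ) + 1) ^ n + n ≤ X ^ (3 * n + 2) := by
    have := four_mul_le (3 * n)
    have := four_mul_le (3 * n + 1)
    have : X ≤ X ^ (3 * n + 1) := Nat.le_self_pow (by lia) X
    lia
  have hshift : R + N * N * Δ ≤ X ^ 4 := by
    have := four_mul_le 3
    have : X ≤ X ^ 3 := Nat.le_self_pow (by lia) X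
    have : N * N * Δ ≤ X ^ 3 := by
      rw [pow_succ, pow_two]
      gcongr
    lia
  have hsol := solutionBound_le_pow hX hn hrows hNΔ
    (hshift.trans (Nat.pow_le_pow_right (by lia) (by lia)))
  calc walkBound n N Δ R
      ≤ X ^ 2 + X ^ (3 * n) * X ^ ((3 * n + 2 + 2 + (2 + 1) * n + 2) * n) * X := by
        rw [walkBound, pow_two X]
        gcongr
    _ = X ^ 2 + X ^ (6 * n ^ 2 + 9 * n + 1) := by
        rw [← pow_add, ← pow_succ]
        ring_nf
    _ ≤ 4 * X ^ (6 * n ^ 2 + 9 * n + 2) := by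
        have := four_mul_le (6 * n ^ 2 + 9 * n + 1)
        have : X ^ 2 ≤ X ^ (6 * n ^ 2 + 9 * n + 2) := Nat.pow_le_pow_right (by lia) (by lia)
        lia
    _ ≤ X ^ (6 * n ^ 2 + 9 * n + 3) := four_mul_le _

lemma mul_walkBound_add_le_pow (hn2 : 2 ≤ n) (hX : 4 ≤ X) (hn : n + 1 ≤ X) (hN : N ≤ X)
    (hΔ : Δ ≤ X) (hR : R ≤ X) (hK : K ≤ X) (hL : L ≤ X) :
    K * (2 * walkBound n N Δ R + 1) + L ≤ X ^ n ^ 6 := by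
  have four_mul_le : ∀ i, 4 * X ^ i ≤ X ^ (i + 1) := fun i => by rw [pow_succ']; gcongr
  set i := 6 * n ^ 2 + 9 * n + 3
  have hi : 2 * walkBound n N Δ R + 1 ≤ X ^ (i + 1) := by
    have := walkBound_le_pow hX hn hN hΔ hR
    have := four_mul_le i
    have : 0 < X ^ i := Nat.pow_pos (by lia)
    lia
  have hexp : i + 3 ≤ n ^ 6 := by
    have : 2 ^ 4 ≤ n ^ 4 := Nat.pow_le_pow_left hn2 4
    calc i + 3 ≤ 2 ^ 4 * n ^ 2 := by unfold i; nlinarith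
      _ ≤ n ^ 4 * n ^ 2 := by gcongr
      _ = n ^ 6 := by ring
  calc K * (2 * walkBound n N Δ R + 1) + L ≤ X * X ^ (i + 1) + X ^ (i + 2) := by
        gcongr
        exact hL.trans (Nat.le_self_pow (by lia) X)
    _ ≤ 4 * X ^ (i + 2) := by rw [← pow_succ']; lia
    _ ≤ X ^ (i + 3) := four_mul_le _
    _ ≤ X ^ n ^ 6 := Nat.pow_le_pow_right (by lia) hexp

lemma mul_walkBound_add_le_pow_mul (hn : 2 ≤ n) (hB : 4 ≤ B) (hΔ : Δ ≤ B) (hR : R ≤ B)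
    (hK : K ≤ B) (hd : d ≤ B) (hne : n ≤ e) (hL : L ≤ B ^ e) :
    K * (2 * walkBound n ((d * L) ^ n) Δ R + 1) + L ≤ B ^ (e * n ^ 8) := by
  have pow_mono {i j : ℕ} (h : i ≤ j) : B ^ i ≤ B ^ j := Nat.pow_le_pow_right (by lia) h
  have he : e + 1 ≤ e * n := by nlinarith
  have hen : e * n ≤ e * n ^ 2 := by nlinarith
  have hBX : B ≤ B ^ (e * n ^ 2) := Nat.le_self_pow (by lia) B
  have hnX : n + 1 ≤ B ^ (e * n ^ 2) :=
    calc n + 1 ≤ B ^ n := n.lt_pow_self (by lia)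
      _ ≤ B ^ (e * n ^ 2) := pow_mono (by lia)
  have hN : (d * L) ^ n ≤ B ^ (e * n ^ 2) :=
    calc (d * L) ^ n ≤ (B * B ^ e) ^ n := by gcongr
      _ = B ^ ((e + 1) * n) := by rw [← pow_succ', ← pow_mul]
      _ ≤ B ^ (e * n ^ 2) := pow_mono (by nlinarith)
  calc K * (2 * walkBound n ((d * L) ^ n) Δ R + 1) + L
      ≤ (B ^ (e * n ^ 2)) ^ n ^ 6 :=
        mul_walkBound_add_le_pow hn (hB.trans hBX) hnX hN (hΔ.trans hBX) (hR.trans hBX)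
          (hK.trans hBX) (hL.trans (pow_mono (by lia)))
    _ = B ^ (e * n ^ 8) := by rw [← pow_mul, mul_assoc, ← pow_add]

end Bounds

section Induction

variable {ι : Type*} {T : Set (ι → ℤ)} {d Δ R K B : ℕ}

lemma shortSolutions_zero (T : Set (ι → ℤ)) (R K L : ℕ) : ShortSolutions T R K 0 L := by
  rintro (_ | ⟨s, S⟩) v m _ hc _ h
  · cases h
    exact ⟨0, L.zero_le, .nil v⟩
  · exact absurd (hc s List.mem_cons_self) (Nat.not_lt_zero _)

lemma shortSolutions_pow [Fintype ι] (hn : 2 ≤ Fintype.card ι) (hB : 4 ≤ B) (hΔB : Δ ≤ B)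
    (hR : R ≤ B) (hK : K ≤ B) (hdB : d ≤ B) (hΔ1 : 1 ≤ Δ)
    (hΔ : ∀ t ∈ T, ∀ i, (t i).natAbs ≤ Δ) (hd1 : 1 ≤ d) (hd : ∀ t ∈ T, ∀ i, -(d : ℤ) ≤ t i)
    (c : ℕ) : ShortSolutions T R K c (B ^ Fintype.card ι ^ (8 * c + 1)) := by
  induction c with
  | zero => exact shortSolutions_zero T R K _
  | succ c ih =>
    have hb : 1 ≤ d * B ^ Fintype.card ι ^ (8 * c + 1) := Nat.mul_pos hd1 (Nat.pow_pos (by lia))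
    refine (ih.succ hΔ1 hΔ hb hd).mono ?_
    calc _ ≤ B ^ (Fintype.card ι ^ (8 * c + 1) * Fintype.card ι ^ 8) :=
          mul_walkBound_add_le_pow_mul hn hB hΔB hR hK hdB (Nat.le_self_pow (by lia) _) le_rfl
      _ = B ^ Fintype.card ι ^ (8 * (c + 1) + 1) := by
          rw [← pow_add]
          ring_nf

end Induction

section Intervals

variable {R : ℕ} {S : Set ℤ} {a : ℤ}

lemma isRayUnion_of_natAbs_le (h : ∀ e ∈ S, e.natAbs ≤ R) : IsRayUnion R S := fun e he =>
  ⟨e, 0, h e he, by simp, ⟨0, by simp⟩, fun s => by simpa using he⟩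

lemma isRayUnion_Ici (ha : a.natAbs ≤ R) : IsRayUnion R (Set.Ici a) := fun e he =>
  ⟨a, 1, ha, by simp, ⟨(e - a).toNat, by rw [Set.mem_Ici] at he; lia⟩, fun s => by simp⟩

lemma isRayUnion_Iic (ha : a.natAbs ≤ R) : IsRayUnion R (Set.Iic a) := fun e he =>
  ⟨a, -1, ha, by simp, ⟨(a - e).toNat, by rw [Set.mem_Iic] at he; lia⟩, fun s => by simp⟩

lemma Interval.isRayUnion_pos (I : Interval) (hI : I.absMax ≤ R) (hR : 1 ≤ R) :
    IsRayUnion R {x ∈ I.toSet | 0 < x} := by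
  cases I with
  | all =>
    have : {x ∈ all.toSet | 0 < x} = Set.Ici 1 := by ext x; simp [toSet]; lia
    exact this ▸ isRayUnion_Ici hR
  | ge a =>
    have : {x ∈ (ge a).toSet | 0 < x} = Set.Ici (max a 1) := by ext x; simp [toSet]; lia
    exact this ▸ isRayUnion_Ici (by simp only [absMax] at hI; lia)
  | _ =>
    refine isRayUnion_of_natAbs_le fun e he => ?_
    simp only [toSet, absMax, Set.mem_ofPred_eq, Set.mem_Iic, Set.mem_Icc] at he hI
    lia

lemma Interval.isRayUnion_neg (I : Interval) (hI : I.absMax ≤ R) (hR : 1 ≤ R) :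
    IsRayUnion R {x ∈ I.toSet | x < 0} := by
  cases I with
  | all =>
    have : {x ∈ all.toSet | x < 0} = Set.Iic (-1) := by ext x; simp [toSet]; lia
    exact this ▸ isRayUnion_Iic (by simpa)
  | le b =>
    have : {x ∈ (le b).toSet | x < 0} = Set.Iic (min b (-1)) := by ext x; simp [toSet]; lia
    exact this ▸ isRayUnion_Iic (by simp only [absMax] at hI; lia)
  | _ =>
    refine isRayUnion_of_natAbs_le fun e he => ?_
    simp only [toSet, absMax, Set.mem_ofPred_eq, Set.mem_Ici, Set.mem_Icc] at he hI
    lia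

lemma Interval.isRayUnion_sign_eq (I : Interval) (hI : I.absMax ≤ R) (hR : 1 ≤ R) (y : ℤ) :
    IsRayUnion R {x ∈ I.toSet | x.sign = y.sign} := by
  rcases Int.sign_trichotomy y with hy | hy | hy <;> rw [hy]
  · simpa only [Int.sign_eq_one_iff_pos] using I.isRayUnion_pos hI hR
  · exact isRayUnion_of_natAbs_le fun e he => by simp [Int.sign_eq_zero_iff_zero.mp he.2]
  · simpa only [Int.sign_eq_neg_one_iff_neg] using I.isRayUnion_neg hI hR

end Intervals

section Runs

namespace PseudoRun

variable {n : ℕ} {T : Finset (Fin n → ℤ)} {ρ : PseudoRun T} {A : Finset (Fin n)} {a b c K : ℕ}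
  {f : ℕ → ℕ}

/-- The path between the positions `a` and `b` of the pseudo-run. -/
def slice (ρ : PseudoRun T) (a b : ℕ) : List (Fin n → ℤ) :=
  (ρ.path.drop a).take (b - a)

lemma slice_append_slice (hab : a ≤ b) (hbc : b ≤ c) :
    ρ.slice a b ++ ρ.slice b c = ρ.slice a c := by
  rw [slice, slice, slice, ← Nat.sub_add_sub_cancel hbc hab, Nat.add_comm (c - b), List.take_add,
    List.drop_drop, Nat.add_sub_cancel' hab]

lemma config_add_sum_slice (hab : a ≤ b) : ρ.config a + (ρ.slice a b).sum = ρ.config b := by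
  rw [config, config, slice, add_assoc, ← List.sum_append, ← List.take_add,
    Nat.add_sub_cancel' hab]

lemma sum_slice_effect {l : ℕ} (h : f (2 * l + 1) ≤ f (2 * l + 2)) :
    (ρ.slice (f (2 * l + 1)) (f (2 * l + 2))).sum = ρ.effect f l := by
  rw [effect, ← config_add_sum_slice h, add_sub_cancel_left]

lemma exists_eq_slice_of_prefix (hab : a ≤ b) {q : List (Fin n → ℤ)} (hq : q <+: ρ.slice a b) :
    ∃ i, a ≤ i ∧ i ≤ b ∧ q = ρ.slice a i := by
  have hlen : q.length ≤ b - a := hq.length_le.trans (List.length_take_le _ _)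
  refine ⟨a + q.length, by lia, by lia, ?_⟩
  rw [slice, Nat.add_sub_cancel_left]
  conv_lhs => rw [List.prefix_iff_eq_take.mp hq, slice, List.take_take, min_eq_left hlen]

lemma isSafe_slice (hab : a ≤ b) (h : ∀ i, a ≤ i → i ≤ b → ∀ j ∈ A, 0 ≤ ρ.config i j) :
    IsSafe T A (ρ.config a) (ρ.slice a b) where
  mem t ht := ρ.path_mem t (List.mem_of_mem_drop (List.mem_of_mem_take ht))
  visited_subset := by
    rintro _ ⟨q, hq, rfl⟩
    obtain ⟨i, hai, hib, rfl⟩ := exists_eq_slice_of_prefix hab hq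
    rw [AddMonoidHom.id_apply, config_add_sum_slice hai]
    exact h i hai hib

/-- The pseudo-run that takes the steps in `r` and then continues as `ρ` does. -/
def prepend (r : List (Fin n → ℤ)) (hr : ∀ t ∈ r, t ∈ T) (ρ : PseudoRun T) : PseudoRun T :=
  ⟨ρ.start - r.sum, r ++ ρ.path, List.forall_mem_append.mpr ⟨hr, ρ.path_mem⟩⟩

variable {r : List (Fin n → ℤ)} {hr : ∀ t ∈ r, t ∈ T}

lemma config_prepend_of_le {i : ℕ} (hi : i ≤ r.length) :
    (ρ.prepend r hr).config i = ρ.start - r.sum + (r.take i).sum := by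
  simp only [config, prepend, List.take_append_of_le_length hi]

lemma config_prepend_add (i : ℕ) : (ρ.prepend r hr).config (r.length + i) = ρ.config i := by
  simp only [config, prepend, List.take_length_add_append, List.sum_append]
  abel

lemma IsDecomposition.mono (h : ρ.IsDecomposition K f) (hab : a ≤ b) (hb : b ≤ 2 * K) :
    f a ≤ f b := by
  induction b, hab using Nat.le_induction with
  | base => exact le_rfl
  | succ b _ ih => exact (ih (by lia)).trans (h.2.2 b (by lia))

lemma IsDecomposition.exists_mem_segment (h : ρ.IsDecomposition K f) (hK : 1 ≤ K) {i : ℕ}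
    (hi : i ≤ ρ.path.length) :
    ∃ l < K, f (2 * l) ≤ i ∧ i ≤ f (2 * l + 2) ∧ ∀ l' < l, f (2 * l' + 2) < i := by
  have hlast : i ≤ f (2 * (K - 1) + 2) := by
    rwa [show 2 * (K - 1) + 2 = 2 * K by lia, h.2.1]
  have hex : ∃ l, i ≤ f (2 * l + 2) := ⟨_, hlast⟩
  refine ⟨Nat.find hex, by have := Nat.find_min' hex hlast; lia, ?_, Nat.find_spec hex,
    fun l' hl' => not_le.mp (Nat.find_min hex hl')⟩
  rcases hl : Nat.find hex with _ | l
  · simpa only [mul_zero, h.1] using i.zero_le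
  · exact (not_le.mp (Nat.find_min hex (hl ▸ l.lt_succ_self))).le

/-- The pseudo-run is a sequence of segments as described by the list `S`, where the `l`-th one
starts at position `f (2 * l)` and the part that has to meet its target at `f (2 * l + 1)`. -/
structure Follows (ρ : PseudoRun T) (S : List (Segment (Fin n))) (f : ℕ → ℕ) : Prop where
  isDecomposition : ρ.IsDecomposition S.length f
  effect_mem : ∀ (l : ℕ) (hl : l < S.length) (j : Fin n), ρ.effect f l j ∈ S[l].target j
  nonneg : ∀ (l : ℕ) (hl : l < S.length) (i : ℕ), f (2 * l) ≤ i → i ≤ f (2 * l + 2) →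
    ∀ j ∈ S[l].coords, 0 ≤ ρ.config i j

variable {s : Segment (Fin n)} {S : List (Segment (Fin n))}

lemma Follows.exists_hasSolution_drop (h : ρ.Follows S f) {l : ℕ} (hl : l ≤ S.length) :
    ∃ m, HasSolution T (S.drop l) (ρ.config (f (2 * l))) m := by
  induction hl using Nat.decreasingInduction with
  | self => exact ⟨0, by simpa using .nil _⟩
  | of_succ l hl ih =>
    obtain ⟨m, hm⟩ := ih
    have h₁ : f (2 * l) ≤ f (2 * l + 1) := h.isDecomposition.2.2 _ (by lia)
    have h₂ : f (2 * l + 1) ≤ f (2 * l + 2) := h.isDecomposition.2.2 _ (by lia)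
    rw [List.drop_eq_getElem_cons hl]
    refine ⟨_, .cons (m := m) (ρ.slice (f (2 * l)) (f (2 * l + 1)))
      (ρ.slice (f (2 * l + 1)) (f (2 * l + 2))) ?_ ?_ ?_⟩
    · rw [slice_append_slice h₁ h₂]
      exact isSafe_slice (h₁.trans h₂) (h.nonneg l hl)
    · rw [sum_slice_effect h₂]
      exact h.effect_mem l hl
    · rwa [slice_append_slice h₁ h₂, config_add_sum_slice (h₁.trans h₂)]

lemma Follows.exists_hasSolution (h : ρ.Follows S f) : ∃ m, HasSolution T S ρ.start m := by
  simpa [config, h.isDecomposition.1] using h.exists_hasSolution_drop (Nat.zero_le _)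

/-- The positions of a sequence of segments that is prepended by a segment of length `b` whose
second part starts at `a`. -/
def prependPositions (a b : ℕ) (f : ℕ → ℕ) : ℕ → ℕ
  | 0 => 0
  | 1 => a
  | k + 2 => b + f k

lemma IsDecomposition.prepend {p q : List (Fin n → ℤ)} (hpq : ∀ t ∈ p ++ q, t ∈ T)
    (h : ρ.IsDecomposition K f) : (ρ.prepend (p ++ q) hpq).IsDecomposition (K + 1)
      (prependPositions p.length (p ++ q).length f) := by
  refine ⟨rfl, ?_, ?_⟩
  · simp only [mul_add_one, prependPositions, h.2.1, PseudoRun.prepend, List.length_append]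
  · rintro (_ | _ | i) hi
    · exact Nat.zero_le _
    · simp [prependPositions, add_assoc]
    · exact Nat.add_le_add_left (h.2.2 i (by lia)) _

lemma effect_prepend_zero {p q : List (Fin n → ℤ)} (hpq : ∀ t ∈ p ++ q, t ∈ T) (hf : f 0 = 0) :
    (ρ.prepend (p ++ q) hpq).effect (prependPositions p.length (p ++ q).length f) 0 = q.sum := by
  simp only [effect, prependPositions, hf, add_zero]
  rw [config_prepend_of_le le_rfl, config_prepend_of_le (by simp), List.take_length, List.take_left,
    List.sum_append]
  abel

lemma effect_prepend_succ (a l : ℕ) :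
    (ρ.prepend r hr).effect (prependPositions a r.length f) (l + 1) = ρ.effect f l := by
  simp only [effect, mul_add_one, prependPositions, config_prepend_add]

lemma Follows.prepend {p q : List (Fin n → ℤ)} (h : ρ.Follows S f) {v : Fin n → ℤ}
    (hs : IsSafe T s.coords v (p ++ q)) (hq : ∀ j, q.sum j ∈ s.target j)
    (hv : ρ.start = v + (p ++ q).sum) : (ρ.prepend (p ++ q) hs.mem).Follows (s :: S)
      (prependPositions p.length (p ++ q).length f) := by
  have hf0 := h.isDecomposition.1
  refine ⟨h.isDecomposition.prepend hs.mem, ?_, ?_⟩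
  · rintro (_ | l) hl j
    · rw [effect_prepend_zero hs.mem hf0]
      exact hq j
    · rw [effect_prepend_succ]
      exact h.effect_mem l (by simpa using hl) j
  · rintro (_ | l) hl i hi hi' j hj
    · have hi' : i ≤ (p ++ q).length := by simpa only [prependPositions, hf0, add_zero] using hi'
      rw [config_prepend_of_le hi', hv, add_sub_cancel_right]
      exact hs.visited_subset ⟨_, List.take_prefix _ _, rfl⟩ j hj
    · simp only [mul_add_one, prependPositions] at hi hi'
      obtain ⟨i, rfl⟩ := Nat.exists_eq_add_of_le (le_of_add_le_left hi)
      rw [config_prepend_add]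
      exact h.nonneg l (by simpa using hl) i (by lia) (by lia) j hj

end PseudoRun

variable {n : ℕ} {T : Finset (Fin n → ℤ)} {S : List (Segment (Fin n))}

lemma HasSolution.exists_follows {v : Fin n → ℤ} {m : ℕ}
    (h : HasSolution (T : Set (Fin n → ℤ)) S v m) :
    ∃ (ρ : PseudoRun T) (f : ℕ → ℕ), ρ.start = v ∧ ρ.path.length = m ∧ ρ.Follows S f := by
  induction h with
  | nil v => exact ⟨⟨v, [], by simp⟩, 0, rfl, rfl, ⟨⟨rfl, rfl, by simp⟩, by simp, by simp⟩⟩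
  | cons p q hs hq _ ih =>
    obtain ⟨ρ, f, hstart, rfl, hρ⟩ := ih
    exact ⟨_, _, by simp [PseudoRun.prepend, hstart], by simp [PseudoRun.prepend, add_assoc],
      hρ.prepend hs hq hstart⟩

end Runs

section WeakSatisfaction

variable {n K R L : ℕ} {T : Finset (Fin n → ℤ)} {P : Property n K} {e e' : Fin K → Fin n → ℤ}

/-- Condition (P2) for the effects `e` of the segments of a pseudo-run. -/
def NegAfterPos (e : Fin K → Fin n → ℤ) : Prop :=
  ∀ l j, e l j < 0 → ∃ l' < l, 0 < e l' j

lemma NegAfterPos.of_sign_eq (he : NegAfterPos e) (h : ∀ l j, (e' l j).sign = (e l j).sign) :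
    NegAfterPos e' := by
  have hneg l j : e' l j < 0 ↔ e l j < 0 := by
    rw [← Int.sign_eq_neg_one_iff_neg, h, Int.sign_eq_neg_one_iff_neg]
  have hpos l j : 0 < e' l j ↔ 0 < e l j := by
    rw [← Int.sign_eq_one_iff_pos, h, Int.sign_eq_one_iff_pos]
  simpa only [NegAfterPos, hneg, hpos] using he

/-- The segments of a pseudo-run that weakly satisfies `P` where the effects have the same signs as
those in `e`: a coordinate has to be nonnegative until it has increased in some segment. -/
def segments (P : Property n K) (e : Fin K → Fin n → ℤ) : List (Segment (Fin n)) :=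
  List.ofFn fun l =>
    { coords := {j | ∀ l' < l, e l' j ≤ 0}
      target := fun j => {x ∈ (P l j).toSet | x.sign = (e l j).sign} }

lemma length_segments (P : Property n K) (e : Fin K → Fin n → ℤ) : (segments P e).length = K :=
  List.length_ofFn

lemma NegAfterPos.wellFormed_segments (he : NegAfterPos e) (hR : 1 ≤ R)
    (hP : ∀ l j, (P l j).absMax ≤ R) : WellFormed R (segments P e) where
  isAdmissible := List.forall_mem_ofFn_iff.mpr fun l =>
    { isRayUnion := fun j => (P l j).isRayUnion_sign_eq (hP l j) hR (e l j)
      nonneg := by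
        rintro j hj x ⟨-, hx⟩
        rw [← Int.sign_nonneg_iff, hx, Int.sign_nonneg_iff]
        by_contra! hneg
        obtain ⟨l', hl', hpos⟩ := he l j hneg
        exact hpos.not_ge ((Finset.mem_filter_univ j).mp hj l' hl') }
  pairwise := List.pairwise_ofFn.mpr fun _ _ hl =>
    Finset.monotone_filter_right _ fun _ _ hj l₀ hl₀ => hj l₀ (hl₀.trans hl)

namespace PseudoRun

variable {ρ : PseudoRun T} {f : ℕ → ℕ}

lemma WeaklySatisfies.exists_follows (h : ρ.WeaklySatisfies P) :
    ∃ e f, NegAfterPos e ∧ ρ.Follows (segments P e) f := by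
  obtain ⟨f, hf, hmem, hneg, hnonneg⟩ := h
  refine ⟨fun l => ρ.effect f l, f, hneg, by rwa [length_segments], ?_, ?_⟩
  · intro l hl j
    rw [length_segments] at hl
    simpa [segments] using hmem ⟨l, hl⟩ j
  · intro l hl i _ hil j hj
    rw [length_segments] at hl
    simp only [segments, List.getElem_ofFn, Finset.mem_filter_univ] at hj
    by_contra! hi
    obtain ⟨l', hl', hpos⟩ := hnonneg j i
      (hil.trans (hf.2.1 ▸ hf.mono (by lia) le_rfl)) hi
    rcases lt_or_ge (l' : ℕ) l with hlt | hge
    · exact hpos.not_ge (hj l' hlt)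
    · exact (hl'.trans_le hil).not_ge (hf.mono (by lia) (by lia))

lemma Follows.weaklySatisfies (h : ρ.Follows (segments P e) f) (he : NegAfterPos e) (hK : 1 ≤ K) :
    ρ.WeaklySatisfies P := by
  have hf := h.isDecomposition
  rw [length_segments] at hf
  have heffect (l : Fin K) (j : Fin n) :
      ρ.effect f l j ∈ (P l j).toSet ∧ (ρ.effect f l j).sign = (e l j).sign := by
    simpa [segments] using h.effect_mem l (by simp [length_segments]) j
  refine ⟨f, hf, fun l j => (heffect l j).1, he.of_sign_eq fun l j => (heffect l j).2, ?_⟩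
  intro j i hi hneg
  by_contra! hno
  obtain ⟨l, hl, hli, hil, hbefore⟩ := hf.exists_mem_segment hK hi
  refine hneg.not_ge (h.nonneg l (by rwa [length_segments]) i hli hil j ?_)
  simp only [segments, List.getElem_ofFn, Finset.mem_filter_univ]
  intro l' hl'
  have := hno l' (hbefore l' hl')
  rwa [← not_lt, ← Int.sign_eq_one_iff_pos, (heffect l' j).2, Int.sign_eq_one_iff_pos,
    not_lt] at this

lemma WeaklySatisfies.exists_short (h : ρ.WeaklySatisfies P) (hK : 1 ≤ K) (hR : 1 ≤ R)
    (hP : ∀ l j, (P l j).absMax ≤ R) (hL : ShortSolutions (T : Set (Fin n → ℤ)) R K (n + 1) L) :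
    ∃ ρ' : PseudoRun T, ρ'.start = ρ.start ∧ ρ'.WeaklySatisfies P ∧ ρ'.length ≤ L + 1 := by
  obtain ⟨e, f, he, hf⟩ := h.exists_follows
  obtain ⟨m, hm⟩ := hf.exists_hasSolution
  have hcard (s : Segment (Fin n)) : s.coords.card < n + 1 :=
    Nat.lt_succ_of_le (card_finset_fin_le s.coords)
  obtain ⟨m', hm', hsol⟩ := hL _ _ m (he.wellFormed_segments hR hP) (fun s _ => hcard s)
    (length_segments P e).le hm
  obtain ⟨ρ', f', hstart, rfl, hf'⟩ := hsol.exists_follows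
  exact ⟨ρ', hstart, hf'.weaklySatisfies he hK, Nat.succ_le_succ hm'⟩

end PseudoRun

end WeakSatisfaction

section Norms

variable {n K : ℕ} {T : Finset (Fin n → ℤ)} {t : Fin n → ℤ}

lemma natAbs_le_absNorm (ht : t ∈ T) (j : Fin n) : (t j).natAbs ≤ absNorm T :=
  (Finset.le_sup (f := fun i => (t i).natAbs) (Finset.mem_univ j)).trans
    (Finset.le_sup (f := fun b : Fin n → ℤ => Finset.univ.sup fun i => (b i).natAbs) ht)

lemma neg_negNorm_le (ht : t ∈ T) (j : Fin n) : -(negNorm T : ℤ) ≤ t j := by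
  have : (-(t j)).toNat ≤ negNorm T :=
    (Finset.le_sup (f := fun i => (-(t i)).toNat) (Finset.mem_univ j)).trans
      (Finset.le_sup (f := fun b : Fin n → ℤ => Finset.univ.sup fun i => (-(b i)).toNat) ht)
  lia

lemma negNorm_le_absNorm (T : Finset (Fin n → ℤ)) : negNorm T ≤ absNorm T :=
  Finset.sup_mono_fun fun _ _ => Finset.sup_mono_fun fun _ _ => by lia

lemma Property.one_le_scale (P : Property n K) : 1 ≤ P.scale := le_max_left _ _

lemma Property.absMax_le_scale (P : Property n K) (l : Fin K) (j : Fin n) :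
    (P l j).absMax ≤ P.scale :=
  le_max_of_le_right <| (Finset.le_sup (f := fun j => (P l j).absMax) (Finset.mem_univ j)).trans
    (Finset.le_sup (f := fun l => Finset.univ.sup fun j => (P l j).absMax) (Finset.mem_univ l))

end Norms

section MainBound

variable {n K Δ R d B : ℕ}

lemma le_two_mul_mul (hΔ : 1 ≤ Δ) (hR : 1 ≤ R) (hd : 1 ≤ d) :
    2 * (1 + K) ≤ 2 * ((1 + K) * Δ * R) * d ∧ Δ ≤ 2 * ((1 + K) * Δ * R) * d ∧
      R ≤ 2 * ((1 + K) * Δ * R) * d ∧ d ≤ 2 * ((1 + K) * Δ * R) * d := by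
  have (x y : ℕ) (hy : 0 < y) (h : x * y = 2 * ((1 + K) * Δ * R) * d) :
      x ≤ 2 * ((1 + K) * Δ * R) * d := h ▸ Nat.le_mul_of_pos_right x hy
  exact ⟨this _ (Δ * R * d) (by positivity) (by ring),
    this _ (2 * (1 + K) * R * d) (by positivity) (by ring),
    this _ (2 * (1 + K) * Δ * d) (by positivity) (by ring),
    this _ (2 * (1 + K) * Δ * R) (by positivity) (by ring)⟩

lemma pow_pow_add_one_le (hn : 2 ≤ n) (hB : 2 ≤ B) :
    B ^ n ^ (8 * (n + 1) + 1) + 1 ≤ B ^ n ^ ((2 * n + 1) * 8) := by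
  have hexp : n ^ (8 * (n + 1) + 1) < n ^ ((2 * n + 1) * 8) :=
    Nat.pow_lt_pow_right (by lia) (by lia)
  exact Nat.pow_lt_pow_right hB hexp

end MainBound

end GenUnbound

theorem mainTheorem4 :
    ∃ C : ℕ, 1 < C ∧
      ∀ (n : ℕ), 2 ≤ n →
      ∀ (T : Finset (Fin n → ℤ)), 1 ≤ GenUnbound.negNorm T →
      ∀ (K : ℕ), 1 ≤ K →
      ∀ (P : GenUnbound.Property n K) (ρ : GenUnbound.PseudoRun T), ρ.WeaklySatisfies P →
      ∃ ρ' : GenUnbound.PseudoRun T, ρ'.start = ρ.start ∧ ρ'.WeaklySatisfies P ∧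
        ρ'.length ≤
          (2 * ((1 + K) * GenUnbound.absNorm T * P.scale) * GenUnbound.negNorm T) ^
            (n ^ ((2 * n + 1) * C)) := by
  refine ⟨8, by norm_num, fun n hn T hT K hK P ρ hρ => ?_⟩
  have hΔ : 1 ≤ GenUnbound.absNorm T := hT.trans (GenUnbound.negNorm_le_absNorm T)
  obtain ⟨hBK, hBΔ, hBR, hBd⟩ := GenUnbound.le_two_mul_mul (K := K) hΔ P.one_le_scale hT
  set B := 2 * ((1 + K) * GenUnbound.absNorm T * P.scale) * GenUnbound.negNorm T
  have hshort := GenUnbound.shortSolutions_pow (T := (T : Set (Fin n → ℤ))) (K := K) (B := B)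
    (by rwa [Fintype.card_fin]) (by lia) hBΔ hBR (by lia) hBd hΔ
    (fun _ ht => GenUnbound.natAbs_le_absNorm ht) hT
    (fun _ ht => GenUnbound.neg_negNorm_le ht) (n + 1)
  rw [Fintype.card_fin] at hshort
  obtain ⟨ρ', hstart, hsat, hlen⟩ :=
    hρ.exists_short hK P.one_le_scale P.absMax_le_scale hshort
  exact ⟨ρ', hstart, hsat, hlen.trans (GenUnbound.pow_pow_add_one_le hn (by lia))⟩
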